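/- Let $G$ be a group and let $A\le \mathrm{Aut}(G)$ be a group of automorphisms of $G$ that is normalized by $\mathrm{Inn}(G)$ and is finite-by-hypercentral, i.e. $A$ has a finite normal subgroup $F$ such that $A/F$ is hypercentral (some term of the transfinite upper central series of $A/F$ equals $A/F$). By an ascending $G$-series of a normal subgroup $K$ of $G$ we mean a family $(S_\beta)_{\beta\le\tau}$ of normal subgroups of $G$, indexed by the ordinals up to some ordinal $\tau$, with $S_0=1$, $S_\tau=K$, $S_\beta\le S_\gamma$ whenever $\beta\le\gamma$, and $S_\lambda=\bigcup_{\beta<\lambda}S_\beta$ for limit ordinals $\lambda\le\tau$; its factors are the quotients $S_{\beta+1}/S_\beta$ with $\beta<\tau$. We say that $A$ acts trivially on the factor $S_{\beta+1}/S_\beta$ if $g^{-1}a(g)\in S_\beta$ for all $g\in S_{\beta+1}$ and $a\in A$, and that $A$ stabilizes the series if it acts trivially on all its factors. A subgroup $H$ of $G$ is an $A$-subgroup if $a(H)=H$ for all $a\in A$; if it is also normal in $G$, then $A$ acts on $G/H$ by $a(gH)=a(g)H$, and ascending $G$-series of $G/H$ are the ascending series, in the above sense, consisting of normal subgroups of $G/H$.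 Suppose that $G$ has an ascending $G$-series (from $1$ to $G$) such that finitely many of its factors are finite and $A$ acts trivially on all the other factors. (These finitely many factors need not be all the finite factors of the series.) Then: (i) there is a normal $A$-subgroup $G_0$ of finite index in $G$ such that $A$ stabilizes an ascending $G$-series of $G_0$; (ii) there is a finite normal $A$-subgroup $L$ of $G$ such that $A$ stabilizes an ascending $G$-series of $G/L$. -/

import Mathlib

universe u

/-- The next step of the upper central series: for a normal subgroup `H` of `G`, the (normal)
subgroup `K` with `K / H = Z(G / H)`. -/
def centerStep {G : Type u} [Group G] (H : {H : Subgroup G // H.Normal}) :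
    {H : Subgroup G // H.Normal} :=
  haveI := H.2
  ⟨(Subgroup.center (G ⧸ H.1)).comap (QuotientGroup.mk' H.1), inferInstance⟩

/-- The transfinite upper central series, each term bundled with its normality:
`Z_0 = 1`, `Z_{α+1} / Z_α = Z(G / Z_α)`, and `Z_l` is the join (equivalently, as the terms form
a chain, the union) of the earlier terms when `l` is a limit ordinal. -/
noncomputable def transfiniteCenterAux (G : Type u) [Group G] (α : Ordinal.{u}) :
    {H : Subgroup G // H.Normal} :=
  Ordinal.limitRecOn α ⟨⊥, inferInstance⟩ (fun _ H => centerStep H)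
    (fun l _ ih => ⟨⨆ b : Set.Iio l, (ih b.1 b.2).1,
      haveI : ∀ b : Set.Iio l, (ih b.1 b.2).1.Normal := fun b => (ih b.1 b.2).2
      Subgroup.iSup_normal _⟩)

/-- `Z_α(G)`, the `α`-th term of the transfinite upper central series of `G`. -/
noncomputable def transfiniteCenter (G : Type u) [Group G] (α : Ordinal.{u}) : Subgroup G :=
  (transfiniteCenterAux G α).1

/-- `G` is hypercentral: some term of its transfinite upper central series is all of `G`
(that is, `G` coincides with its hypercenter, the last term of that series). -/
def IsHypercentral (G : Type u) [Group G] : Prop :=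
  ∃ α : Ordinal.{u}, transfiniteCenter G α = ⊤

/-- `G` has a finite normal subgroup with hypercentral quotient. -/
def IsFiniteByHypercentral (G : Type u) [Group G] : Prop :=
  ∃ (L : Subgroup G) (_ : L.Normal), Finite L ∧ IsHypercentral (G ⧸ L)

/-- The subgroup `H` of `G` is invariant under the group `A` of automorphisms of `G`. -/
def IsInvariantUnder {G : Type u} [Group G] (A : Subgroup (MulAut G)) (H : Subgroup G) : Prop :=
  ∀ a ∈ A, H.map (a : G ≃* G).toMonoidHom = H

/-- The action of `A` on `G / L`, for a normal `A`-invariant subgroup `L`; the automorphism `a`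
sends the coset `g L` to `(a g) L`. -/
def quotientAction {G : Type u} [Group G] (A : Subgroup (MulAut G)) (L : Subgroup G) [L.Normal]
    (hL : IsInvariantUnder A L) : A →* MulAut (G ⧸ L) where
  toFun a := QuotientGroup.congr L L a.1 (hL a.1 a.2)
  map_one' := by
    ext x
    induction x using QuotientGroup.induction_on with
    | H g => rfl
  map_mul' a b := by
    ext x
    induction x using QuotientGroup.induction_on with
    | H g => rfl

/-- `(S β)`, for `β ≤ τ`, is an ascending series from `1` to `K` all of whose terms are normal
subgroups of `G`, with unions at limit ordinals. Values `S β` with `β > τ` are irrelevant, and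
repetitions are allowed. -/
structure IsAscendingNormalSeries {G : Type u} [Group G] (S : Ordinal.{u} → Subgroup G)
    (τ : Ordinal.{u}) (K : Subgroup G) : Prop where
  normal : ∀ β ≤ τ, (S β).Normal
  mono : ∀ β γ, β ≤ γ → γ ≤ τ → S β ≤ S γ
  zero : S 0 = ⊥
  last : S τ = K
  limit : ∀ l ≤ τ, Order.IsSuccLimit l → ∀ x, x ∈ S l ↔ ∃ β < l, x ∈ S β

/-- The factor `S (β + 1) / S β` is finite. -/
def FactorFinite {G : Type u} [Group G] (S : Ordinal.{u} → Subgroup G) (β : Ordinal.{u}) : Prop :=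
  Finite (S (β + 1) ⧸ (S β).subgroupOf (S (β + 1)))

/-- `B`, acting on `G` by automorphisms through `φ`, acts trivially on the factor
`S (β + 1) / S β`: every `g ∈ S (β + 1)` has `g (S β) = (b g) (S β)` for all `b`. -/
def ActsTriviallyOnFactor {G : Type u} [Group G] {B : Type u} [Group B] (φ : B →* MulAut G)
    (S : Ordinal.{u} → Subgroup G) (β : Ordinal.{u}) : Prop :=
  ∀ b : B, ∀ g ∈ S (β + 1), g⁻¹ * φ b g ∈ S β

/-- `B`, acting on `G` through `φ`, stabilizes the series `(S β)`, `β ≤ τ`: it acts trivially on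
every factor. -/
def Stabilizes {G : Type u} [Group G] {B : Type u} [Group B] (φ : B →* MulAut G)
    (S : Ordinal.{u} → Subgroup G) (τ : Ordinal.{u}) : Prop :=
  ∀ β < τ, ActsTriviallyOnFactor φ S β

/-! Call `G/L` hypertrivial when `hull φ L = ⊤`, that is, when adjoining fixed points transfinitely,
starting from `L`, exhausts `G`. Thus `hull φ ⊥` is the analogue of the hypercentre, and the claims
become: (i) `hull φ ⊥` has finite index; (ii) `hull φ L = ⊤` for some finite admissible `L`.

The hypothesis on `A` enters through its finite residual `R`, the least finite normal subgroup with
hypercentral quotient. Being least, `R` is preserved by conjugation with `Inn(G)`, and it acts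
trivially on hypertrivial factors (`IsFiniteResidual.inv_mul_apply_mem`).

For (ii), one climbs the series, keeping a finite `L` such that `hull φ L` meets the current term in
finite index (`IsAscendingNormalSeries.exists_finite_relIndex`). A finite factor costs only finite
index; before a trivial factor the finite index is traded for a new finite subgroup, since
hypertrivial-by-finite implies finite-by-hypertrivial (`exists_finite_le_hull_of_relIndex`). For
that, `[K, A]` induces inner automorphisms lying in `A`, so up to hypertrivial factors `K` can be
replaced by a group with centre of finite index, and by Schur's theorem by an abelian group `X`.
There `[X, R]` is finite, so the operators may be taken hypercentral, and Fitting's lemma for `x ↦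
x⁻¹ a(x)` splits a finite submodule off each nontrivial irreducible factor
(`exists_finite_supplement`).

Claim (i) follows from (ii) applied to `G / hull φ ⊥`, where there are no fixed points: a
finite-by-hypertrivial group without fixed points is finite (`finite_of_fixedPointFree`). -/

/-! ### Fixed points of operator groups and their hulls. -/

section OperatorGroups

variable {G B : Type*} [Group G] [Group B]

/-- A normal subgroup that is mapped into itself by all operators. -/
structure AdmissibleNormal (φ : B →* MulAut G) (N : Subgroup G) : Prop where
  normal : N.Normal
  apply_mem : ∀ b, ∀ x ∈ N, φ b x ∈ N

/-- The operators form a set of automorphisms normalized by the inner automorphisms. -/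
def InnNormalized (φ : B →* MulAut G) : Prop :=
  ∀ g b, ∃ b', ∀ x, φ b' x = g * φ b (g⁻¹ * x * g) * g⁻¹

/-- Every element fixed by the operators modulo `N` lies in `N`. -/
def FixedClosed (φ : B →* MulAut G) (N : Subgroup G) : Prop :=
  ∀ x, (∀ b, x⁻¹ * φ b x ∈ N) → x ∈ N

/-- The subgroup generated by the elements that are fixed by the operators modulo `N`. -/
def fixedModulo (φ : B →* MulAut G) (N : Subgroup G) : Subgroup G :=
  Subgroup.closure {x | ∀ b, x⁻¹ * φ b x ∈ N}

/-- The least admissible normal subgroup containing `L` modulo which the operators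
have no nontrivial fixed point. -/
def hull (φ : B →* MulAut G) (L : Subgroup G) : Subgroup G :=
  sInf {N | AdmissibleNormal φ N ∧ FixedClosed φ N ∧ L ≤ N}

variable {φ : B →* MulAut G} {K L N : Subgroup G}

theorem inv_apply_mul (x y : G) (b : B) :
    (x * y)⁻¹ * φ b (x * y) = y⁻¹ * (x⁻¹ * φ b x) * y * (y⁻¹ * φ b y) := by
  rw [map_mul]; group

theorem inv_apply_inv (x : G) (b : B) :
    (x⁻¹)⁻¹ * φ b x⁻¹ = x * (x⁻¹ * φ b x)⁻¹ * x⁻¹ := by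
  rw [map_inv]; group

theorem inv_apply_apply (x : G) (b c : B) :
    (φ b x)⁻¹ * φ c (φ b x) = φ b (x⁻¹ * φ (b⁻¹ * c * b) x) := by
  simp [map_mul]

namespace AdmissibleNormal

theorem conj_mem (hN : AdmissibleNormal φ N) {x : G} (hx : x ∈ N) (g : G) : g * x * g⁻¹ ∈ N :=
  hN.normal.conj_mem x hx g

theorem conj_mem' (hN : AdmissibleNormal φ N) {x : G} (hx : x ∈ N) (g : G) : g⁻¹ * x * g ∈ N := by
  simpa using hN.normal.conj_mem x hx g⁻¹

theorem bot : AdmissibleNormal φ (⊥ : Subgroup G) :=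
  ⟨inferInstance, fun b x hx => by simp_all⟩

theorem top : AdmissibleNormal φ (⊤ : Subgroup G) :=
  ⟨inferInstance, fun _ _ _ => trivial⟩

theorem sInf {c : Set (Subgroup G)} (h : ∀ N ∈ c, AdmissibleNormal φ N) :
    AdmissibleNormal φ (sInf c) where
  normal := ⟨fun x hx g => by
    rw [Subgroup.mem_sInf] at hx ⊢
    exact fun N hN => (h N hN).conj_mem (hx N hN) g⟩
  apply_mem b x hx := by
    rw [Subgroup.mem_sInf] at hx ⊢
    exact fun N hN => (h N hN).apply_mem b x (hx N hN)

theorem inf (hK : AdmissibleNormal φ K) (hN : AdmissibleNormal φ N) :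
    AdmissibleNormal φ (K ⊓ N) where
  normal := by
    have := hK.normal; have := hN.normal; infer_instance
  apply_mem b x hx := ⟨hK.apply_mem b x hx.1, hN.apply_mem b x hx.2⟩

theorem closure {s : Set G} (h₁ : ∀ x ∈ s, ∀ g, g * x * g⁻¹ ∈ s) (h₂ : ∀ x ∈ s, ∀ b, φ b x ∈ s) :
    AdmissibleNormal φ (Subgroup.closure s) where
  normal := ⟨fun x hx g => by
    have : Subgroup.closure s ≤ (Subgroup.closure s).comap (MulAut.conj g).toMonoidHom :=
      (Subgroup.closure_le _).2 fun y hy => Subgroup.subset_closure (h₁ y hy g)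
    exact this hx⟩
  apply_mem b x hx := by
    have : Subgroup.closure s ≤ (Subgroup.closure s).comap (φ b).toMonoidHom :=
      (Subgroup.closure_le _).2 fun y hy => Subgroup.subset_closure (h₂ y hy b)
    exact this hx

theorem sSup_of_isChain {c : Set (Subgroup G)} (hne : c.Nonempty) (hc : IsChain (· ≤ ·) c)
    (h : ∀ N ∈ c, AdmissibleNormal φ N) : AdmissibleNormal φ (sSup c) where
  normal := ⟨fun x hx g => by
    rw [Subgroup.mem_sSup_of_directedOn hne hc.directedOn] at hx ⊢
    obtain ⟨N, hN, hx⟩ := hx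
    exact ⟨N, hN, (h N hN).conj_mem hx g⟩⟩
  apply_mem b x hx := by
    rw [Subgroup.mem_sSup_of_directedOn hne hc.directedOn] at hx ⊢
    obtain ⟨N, hN, hx⟩ := hx
    exact ⟨N, hN, (h N hN).apply_mem b x hx⟩

theorem mem_fixedModulo (hN : N.Normal) {x : G} :
    x ∈ fixedModulo φ N ↔ ∀ b, x⁻¹ * φ b x ∈ N := by
  refine ⟨fun hx => ?_, fun hx => Subgroup.subset_closure hx⟩
  induction hx using Subgroup.closure_induction with
  | mem x h => exact h
  | one => simp
  | mul x y _ _ hx hy =>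
    intro b
    rw [inv_apply_mul]
    exact N.mul_mem (by simpa using hN.conj_mem _ (hx b) y⁻¹) (hy b)
  | inv x _ hx =>
    intro b
    rw [inv_apply_inv]
    exact hN.conj_mem _ (N.inv_mem (hx b)) x

theorem le_fixedModulo (hN : AdmissibleNormal φ N) : N ≤ fixedModulo φ N := fun x hx =>
  Subgroup.subset_closure fun b => N.mul_mem (N.inv_mem hx) (hN.apply_mem b x hx)

/-- Normality is where `InnNormalized` is needed: a conjugate of a fixed point is fixed by the
conjugated operators, which are the same set. -/
theorem fixedModulo (hφ : InnNormalized φ) (hN : AdmissibleNormal φ N) :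
    AdmissibleNormal φ (fixedModulo φ N) := by
  refine closure (fun x hx g b => ?_) (fun x hx c b => ?_)
  · obtain ⟨b', hb'⟩ := hφ g⁻¹ b
    have : (g * x * g⁻¹)⁻¹ * φ b (g * x * g⁻¹) = g * (x⁻¹ * φ b' x) * g⁻¹ := by
      rw [hb']; simp [mul_assoc]
    rw [this]
    exact hN.conj_mem (hx b') g
  · rw [inv_apply_apply]
    exact hN.apply_mem _ _ (hx _)

end AdmissibleNormal

theorem fixedModulo_mono : Monotone (fixedModulo φ) := fun _ _ h =>
  Subgroup.closure_mono fun _ hx b => h (hx b)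

theorem fixedClosed_iff (hN : N.Normal) : FixedClosed φ N ↔ fixedModulo φ N ≤ N :=
  ⟨fun h _ hx => h _ ((AdmissibleNormal.mem_fixedModulo hN).1 hx),
    fun h _ hx => h (Subgroup.subset_closure hx)⟩

theorem admissibleNormal_hull : AdmissibleNormal φ (hull φ L) :=
  AdmissibleNormal.sInf fun _ h => h.1

theorem fixedClosed_hull : FixedClosed φ (hull φ L) := fun x hx => by
  simp only [hull, Subgroup.mem_sInf] at hx ⊢
  exact fun N hN => hN.2.1 x fun b => hx b N hN

theorem le_hull : L ≤ hull φ L := le_sInf fun _ h => h.2.2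

theorem hull_le (h₁ : AdmissibleNormal φ N) (h₂ : FixedClosed φ N) (h : L ≤ N) : hull φ L ≤ N :=
  sInf_le ⟨h₁, h₂, h⟩

theorem hull_le_hull (h : K ≤ hull φ L) : hull φ K ≤ hull φ L :=
  hull_le admissibleNormal_hull fixedClosed_hull h

theorem hull_mono (h : K ≤ L) : hull φ K ≤ hull φ L :=
  hull_le_hull (h.trans le_hull)

/-- An induction principle for `hull φ L`. -/
theorem exists_maximal_admissible (hφ : InnNormalized φ) (hL : AdmissibleNormal φ L)
    (P : Subgroup G → Prop) (hP : P L)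
    (hchain : ∀ c : Set (Subgroup G), c.Nonempty → IsChain (· ≤ ·) c → (∀ N ∈ c, P N) →
      P (sSup c)) :
    ∃ N, AdmissibleNormal φ N ∧ L ≤ N ∧ P N ∧ (hull φ L ≤ N ∨ ¬ P (fixedModulo φ N)) := by
  obtain ⟨N, hLN, hN⟩ := zorn_le_nonempty₀ {N | AdmissibleNormal φ N ∧ P N}
    (fun c hc hcc N hN => ⟨sSup c, ⟨.sSup_of_isChain ⟨N, hN⟩ hcc fun M hM => (hc hM).1,
      hchain c ⟨N, hN⟩ hcc fun M hM => (hc hM).2⟩, fun M hM => le_sSup hM⟩) L ⟨hL, hP⟩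
  refine ⟨N, hN.prop.1, hLN, hN.prop.2, or_iff_not_imp_right.2 fun h => ?_⟩
  -- If `fixedModulo φ N` satisfies `P` too, maximality makes `N` fixed-closed, so `N` is one of the
  -- subgroups intersected in the hull.
  have := hN.le_of_ge ⟨hN.prop.1.fixedModulo hφ, not_not.1 h⟩ hN.prop.1.le_fixedModulo
  exact hull_le hN.prop.1 ((fixedClosed_iff hN.prop.1.normal).2 this) hLN

theorem exists_maximal_admissible_forall (hφ : InnNormalized φ) (hL : AdmissibleNormal φ L)
    (p : G → Prop) (hp : ∀ x ∈ L, p x) :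
    ∃ N, AdmissibleNormal φ N ∧ L ≤ N ∧ (∀ x ∈ N, p x) ∧
      (hull φ L ≤ N ∨ ∃ x, (∀ b, x⁻¹ * φ b x ∈ N) ∧ ¬ p x) := by
  obtain ⟨N, h₁, h₂, h₃, h₄⟩ := exists_maximal_admissible hφ hL (fun N => ∀ x ∈ N, p x) hp
    fun c hne hc h x hx => by
      rw [Subgroup.mem_sSup_of_directedOn hne hc.directedOn] at hx
      obtain ⟨N, hN, hx⟩ := hx
      exact h N hN x hx
  refine ⟨N, h₁, h₂, h₃, h₄.imp id fun h => ?_⟩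
  push Not at h
  obtain ⟨x, hx, hpx⟩ := h
  exact ⟨x, (AdmissibleNormal.mem_fixedModulo h₁.normal).1 hx, hpx⟩

theorem hull_induction (hφ : InnNormalized φ) (hL : AdmissibleNormal φ L)
    (p : G → Prop) (hp : ∀ x ∈ L, p x)
    (hstep : ∀ N, AdmissibleNormal φ N → L ≤ N → (∀ x ∈ N, p x) →
      ∀ x, (∀ b, x⁻¹ * φ b x ∈ N) → p x) : ∀ x ∈ hull φ L, p x := by
  obtain ⟨N, h₁, h₂, h₃, h₄ | ⟨x, hx, hpx⟩⟩ := exists_maximal_admissible_forall hφ hL p hp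
  · exact fun x hx => h₃ x (h₄ hx)
  · exact absurd (hstep N h₁ h₂ h₃ x hx) hpx

/-- An invariant subgroup of `hull φ L` not contained in `L` contains a nontrivial fixed point
modulo `L`. -/
theorem exists_fixed_of_le_hull (hφ : InnNormalized φ) (hL : AdmissibleNormal φ L)
    {H : Subgroup G} (hH : ∀ b, ∀ x ∈ H, φ b x ∈ H) (hHL : H ≤ hull φ L) (hne : ¬ H ≤ L) :
    ∃ x ∈ H, x ∉ L ∧ ∀ b, x⁻¹ * φ b x ∈ L := by
  obtain ⟨N, -, -, h₃, h₄ | ⟨x, hx, hpx⟩⟩ :=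
    exists_maximal_admissible_forall hφ hL (fun x => x ∈ H → x ∈ L) fun x hx _ => hx
  · exact absurd (fun x hx => h₃ x (h₄ (hHL hx)) hx) hne
  · push Not at hpx
    exact ⟨x, hpx.1, hpx.2, fun b => h₃ _ (hx b) (H.mul_mem (H.inv_mem hpx.1) (hH b x hpx.1))⟩

/-- A finite subset of `hull φ L` not contained in `L` is fixed modulo an admissible subgroup
that does not contain it. -/
theorem exists_admissible_of_finite (hφ : InnNormalized φ) (hL : AdmissibleNormal φ L)
    {F : Set G} (hF : F.Finite) (hFL : F ⊆ hull φ L) (hne : ¬ F ⊆ L) :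
    ∃ N, AdmissibleNormal φ N ∧ L ≤ N ∧ ¬ F ⊆ N ∧ ∀ x ∈ F, ∀ b, x⁻¹ * φ b x ∈ N := by
  obtain ⟨N, h₁, h₂, h₃, h₄⟩ := exists_maximal_admissible hφ hL (fun N => ¬ F ⊆ N) hne
    fun c hcne hc h hFc => by
      have : ∀ x ∈ F, ∃ N ∈ c, x ∈ N := fun x hx =>
        (Subgroup.mem_sSup_of_directedOn hcne hc.directedOn).1 (hFc hx)
      -- A finite set covered by a chain lies in one member, so not containing `F` passes to unions
      -- of chains.
      obtain ⟨N, hN, hFN⟩ := DirectedOn.exists_mem_subset_of_finite_of_subset_sUnion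
        (c := (fun N : Subgroup G => (N : Set G)) '' c) (hcne.image _)
        (by
          rintro _ ⟨N, hN, rfl⟩ _ ⟨M, hM, rfl⟩
          obtain ⟨Q, hQ, h₁, h₂⟩ := hc.directedOn N hN M hM
          exact ⟨Q, ⟨Q, hQ, rfl⟩, h₁, h₂⟩) hF
        (fun x hx => by obtain ⟨N, hN, hx⟩ := this x hx; exact ⟨N, ⟨N, hN, rfl⟩, hx⟩)
      obtain ⟨N, hN, rfl⟩ := hN
      exact h N hN hFN
  refine ⟨N, h₁, h₂, h₃, fun x hx => ?_⟩
  have : F ⊆ fixedModulo φ N := by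
    rcases h₄ with h₄ | h₄
    · exact absurd (hFL.trans h₄) h₃
    · exact not_not.1 h₄
  exact (AdmissibleNormal.mem_fixedModulo h₁.normal).1 (this hx)

end OperatorGroups

/-! ### Homomorphisms carrying one set of operators onto another. -/

section SemiEquivariant

variable {G G' B C : Type*} [Group G] [Group G'] [Group B] [Group C]

/-- The homomorphism `f` carries the set of operators on `G` onto the set of operators on `G'`. -/
structure SemiEquivariant (φ : B →* MulAut G) (ψ : C →* MulAut G') (f : G →* G') : Prop where
  exists_right : ∀ b, ∃ c, ∀ x, f (φ b x) = ψ c (f x)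
  exists_left : ∀ c, ∃ b, ∀ x, f (φ b x) = ψ c (f x)

theorem SemiEquivariant.of_equivariant {φ : B →* MulAut G} {ψ : B →* MulAut G'} {f : G →* G'}
    (h : ∀ b x, f (φ b x) = ψ b (f x)) : SemiEquivariant φ ψ f :=
  ⟨fun b => ⟨b, h b⟩, fun b => ⟨b, h b⟩⟩

/-- Conjugation by `g` permutes the operators instead of commuting with them; this is why
equivariance is required only of the sets of operators. -/
theorem InnNormalized.semiEquivariant_conj {φ : B →* MulAut G} (hφ : InnNormalized φ) (g : G) :
    SemiEquivariant φ φ (MulAut.conj g).toMonoidHom := by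
  constructor
  · intro b
    obtain ⟨c, hc⟩ := hφ g b
    exact ⟨c, fun x => by simp [hc, mul_assoc]⟩
  · intro c
    obtain ⟨b, hb⟩ := hφ g⁻¹ c
    exact ⟨b, fun x => by simp [hb, mul_assoc]⟩

variable {φ : B →* MulAut G} {ψ : C →* MulAut G'} {f : G →* G'}
  {L N : Subgroup G} {L' N' : Subgroup G'}

namespace SemiEquivariant

theorem admissibleNormal_comap (hf : SemiEquivariant φ ψ f) (h : AdmissibleNormal ψ N') :
    AdmissibleNormal φ (N'.comap f) where
  normal := h.normal.comap f
  apply_mem b x hx := by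
    obtain ⟨c, hc⟩ := hf.exists_right b
    rw [Subgroup.mem_comap] at hx ⊢
    rw [hc]
    exact h.apply_mem c _ hx

theorem fixedClosed_comap (hf : SemiEquivariant φ ψ f) (h : FixedClosed ψ N') :
    FixedClosed φ (N'.comap f) := fun x hx => h _ fun c => by
  obtain ⟨b, hb⟩ := hf.exists_left c
  simpa [Subgroup.mem_comap, hb] using hx b

theorem hull_le_comap (hf : SemiEquivariant φ ψ f) (h : L ≤ (hull ψ L').comap f) :
    hull φ L ≤ (hull ψ L').comap f :=
  hull_le (hf.admissibleNormal_comap admissibleNormal_hull)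
    (hf.fixedClosed_comap fixedClosed_hull) h

theorem admissibleNormal_map (hf : SemiEquivariant φ ψ f) (hs : Function.Surjective f)
    (h : AdmissibleNormal φ N) : AdmissibleNormal ψ (N.map f) where
  normal := h.normal.map f hs
  apply_mem c y hy := by
    obtain ⟨b, hb⟩ := hf.exists_left c
    obtain ⟨x, hx, rfl⟩ := hy
    exact ⟨φ b x, h.apply_mem b x hx, hb x⟩

theorem fixedClosed_map (hf : SemiEquivariant φ ψ f) (hs : Function.Surjective f)
    (hN : FixedClosed φ N) (hker : f.ker ≤ N) : FixedClosed ψ (N.map f) := by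
  intro y hy
  obtain ⟨x, rfl⟩ := hs y
  refine ⟨x, hN x fun b => ?_, rfl⟩
  obtain ⟨c, hc⟩ := hf.exists_right b
  have := hy c
  rw [← hc, ← map_inv, ← map_mul] at this
  rwa [← Subgroup.mem_comap, Subgroup.comap_map_eq_self hker] at this

/-- With `L' = ⊥` and `f` a quotient map, this reduces questions about hulls over a subgroup to
hulls over `⊥`. -/
theorem comap_hull (hf : SemiEquivariant φ ψ f) (hs : Function.Surjective f) :
    (hull ψ L').comap f = hull φ (L'.comap f) := by
  apply le_antisymm
  · have hker : f.ker ≤ hull φ (L'.comap f) := by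
      refine le_trans (fun x hx => ?_) le_hull
      simp [Subgroup.mem_comap, MonoidHom.mem_ker.1 hx]
    rw [← Subgroup.comap_map_eq_self hker]
    apply Subgroup.comap_mono
    apply hull_le (hf.admissibleNormal_map hs admissibleNormal_hull)
      (hf.fixedClosed_map hs fixedClosed_hull hker)
    rw [← Subgroup.map_comap_eq_self_of_surjective hs L']
    exact Subgroup.map_mono (by rw [Subgroup.map_comap_eq_self_of_surjective hs]; exact le_hull)
  · exact hf.hull_le_comap (Subgroup.comap_mono le_hull)

theorem innNormalized (hf : SemiEquivariant φ ψ f) (hs : Function.Surjective f)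
    (hφ : InnNormalized φ) : InnNormalized ψ := by
  intro g c
  obtain ⟨g, rfl⟩ := hs g
  obtain ⟨b, hb⟩ := hf.exists_left c
  obtain ⟨b', hb'⟩ := hφ g b
  obtain ⟨c', hc'⟩ := hf.exists_right b'
  refine ⟨c', fun y => ?_⟩
  obtain ⟨x, rfl⟩ := hs y
  rw [← hc', hb']
  simp [hb]

end SemiEquivariant

end SemiEquivariant

/-! ### The finite residual and its action on hypertrivial factors. -/

section Residual

variable {G B : Type*} [Group G] [Group B]

/-- The least admissible finite subgroup with hypertrivial quotient. -/
structure IsFiniteResidual (φ : B →* MulAut G) (R : Subgroup G) : Prop where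
  admissible : AdmissibleNormal φ R
  finite : Finite R
  hull_eq : hull φ R = ⊤
  le_of_commutator_mem : ∀ N, AdmissibleNormal φ N → (∀ r ∈ R, ∀ b, r⁻¹ * φ b r ∈ N) → R ≤ N

variable {φ : B →* MulAut G} {K L N R : Subgroup G}

theorem exists_isFiniteResidual (hL : AdmissibleNormal φ L) (hfin : Finite L)
    (h : hull φ L = ⊤) : ∃ R, IsFiniteResidual φ R := by
  have hne : {R : Subgroup G | AdmissibleNormal φ R ∧ Finite R ∧ hull φ R = ⊤}.Nonempty :=
    ⟨L, hL, hfin, h⟩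
  obtain ⟨hR₁, hR₂, hR₃⟩ := Function.argminOn_mem (fun R : Subgroup G => Nat.card R) _ hne
  have hmin := fun S hS => Function.argminOn_le (fun R : Subgroup G => Nat.card R)
    {R : Subgroup G | AdmissibleNormal φ R ∧ Finite R ∧ hull φ R = ⊤} (a := S) hS
  set R := Function.argminOn (fun R : Subgroup G => Nat.card R) _ hne
  refine ⟨R, hR₁, hR₂, hR₃, fun N hN h => ?_⟩
  have hfin' : Finite (R ⊓ N : Subgroup G) :=
    Finite.of_injective _ (Subgroup.inclusion_injective inf_le_left)
  -- Since the displacements of `R` lie in `R ⊓ N`, this smaller subgroup also has hypertrivial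
  -- quotient; minimality of the order forces `R ⊓ N = R`.
  have hle : R ≤ hull φ (R ⊓ N) := fun r hr => fixedClosed_hull r fun b =>
    le_hull ⟨R.mul_mem (R.inv_mem hr) (hR₁.apply_mem b r hr), h r hr b⟩
  have := hmin (R ⊓ N) ⟨hR₁.inf hN, hfin', top_le_iff.1 (hR₃.ge.trans (hull_le_hull hle))⟩
  exact inf_eq_left.1 (Subgroup.eq_of_le_of_card_ge inf_le_left this)

/-- Otherwise the finite set `R` would be fixed modulo some admissible `N` not containing it,
against `le_of_commutator_mem`. -/
theorem IsFiniteResidual.le (hφ : InnNormalized φ) (hR : IsFiniteResidual φ R)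
    (hL : AdmissibleNormal φ L) (h : hull φ L = ⊤) : R ≤ L := by
  by_contra hne
  have := hR.finite
  obtain ⟨N, hN, -, h₁, h₂⟩ := exists_admissible_of_finite hφ hL (F := R) (Set.toFinite _)
    (by simp [h]) hne
  exact h₁ (hR.le_of_commutator_mem N hN h₂)

theorem IsFiniteResidual.apply_mem (hφ : InnNormalized φ) (hR : IsFiniteResidual φ R)
    {f : G →* G} (hf : SemiEquivariant φ φ f) (hs : Function.Surjective f) {r : G} (hr : r ∈ R) :
    f r ∈ R := by
  have : R ≤ R.comap f := hR.le hφ (hf.admissibleNormal_comap hR.admissible) (by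
    rw [← hf.comap_hull hs, hR.hull_eq, Subgroup.comap_top])
  exact this hr

theorem innNormalized_conj : InnNormalized (MulAut.conj : G →* MulAut G) := fun g b =>
  ⟨g * b * g⁻¹, fun x => by simp [mul_assoc]⟩

theorem admissibleNormal_conj_iff : AdmissibleNormal (MulAut.conj : G →* MulAut G) N ↔ N.Normal :=
  ⟨fun h => h.normal, fun h => ⟨h, fun b x hx => by simpa using h.conj_mem x hx b⟩⟩

/-- If `R` is the finite residual of the operator group, then it acts trivially on every
hypertrivial factor. -/
theorem IsFiniteResidual.inv_mul_apply_mem (hφ : InnNormalized φ) {R : Subgroup B}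
    (hR : IsFiniteResidual MulAut.conj R) (hL : AdmissibleNormal φ L) :
    ∀ x ∈ hull φ L, ∀ r ∈ R, x⁻¹ * φ r x ∈ L := by
  suffices ∀ x ∈ hull φ L, x ∈ hull φ L ∧ ∀ r ∈ R, x⁻¹ * φ r x ∈ L from fun x hx => (this x hx).2
  refine hull_induction hφ hL _ (fun x hx => ⟨le_hull hx, fun r _ =>
    L.mul_mem (L.inv_mem hx) (hL.apply_mem r x hx)⟩) fun N hN hLN hN' x hx =>
    ⟨fixedClosed_hull x fun b => (hN' _ (hx b)).1, ?_⟩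
  have hRf := hR.finite
  have hF : ((fun r => x⁻¹ * φ r x) '' (R : Set B)).Finite := (Set.toFinite _).image _
  by_contra hcon
  -- If some `x⁻¹ r(x)` is outside `L`, these finitely many elements are fixed modulo an `M` that
  -- does not contain them all. The `r ∈ R` with `x⁻¹ r(x) ∈ M` form a normal subgroup `Q` with `[R,
  -- B] ≤ Q`, whence `R ≤ Q`, a contradiction.
  obtain ⟨M, hM, hLM, h₁, h₂⟩ := exists_admissible_of_finite hφ hL hF
    (by rintro _ ⟨r, -, rfl⟩; exact (hN' _ (hx r)).1)
    (fun h => hcon fun r hr => h ⟨r, hr, rfl⟩)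
  apply h₁
  have conj_formula : ∀ r b, x⁻¹ * φ (b * r * b⁻¹) x =
      φ b ((x⁻¹ * φ b⁻¹ x)⁻¹ * (x⁻¹ * φ r x) * (x⁻¹ * φ b⁻¹ x) *
        ((x⁻¹ * φ b⁻¹ x)⁻¹ * φ r (x⁻¹ * φ b⁻¹ x))) := by
    intro r b
    simp [mul_assoc]
  have hlast : ∀ r ∈ R, ∀ b, (x⁻¹ * φ b⁻¹ x)⁻¹ * φ r (x⁻¹ * φ b⁻¹ x) ∈ M := fun r hr b =>
    hLM ((hN' _ (hx b⁻¹)).2 r hr)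
  let Q : Subgroup B :=
    { carrier := {r | r ∈ R ∧ x⁻¹ * φ r x ∈ M}
      one_mem' := ⟨R.one_mem, by simp⟩
      mul_mem' := by
        rintro r s ⟨hr, hr'⟩ ⟨hs, hs'⟩
        refine ⟨R.mul_mem hr hs, ?_⟩
        have : x⁻¹ * φ (r * s) x = (x⁻¹ * φ r x) * φ r (x⁻¹ * φ s x) := by simp
        rw [this]
        exact M.mul_mem hr' (hM.apply_mem r _ hs')
      inv_mem' := by
        rintro r ⟨hr, hr'⟩
        refine ⟨R.inv_mem hr, ?_⟩
        have : x⁻¹ * φ r⁻¹ x = (φ r⁻¹ (x⁻¹ * φ r x))⁻¹ := by simp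
        rw [this]
        exact M.inv_mem (hM.apply_mem _ _ hr') }
  have hQ : Q.Normal := ⟨fun r hr b => ⟨hR.admissible.normal.conj_mem r hr.1 b, by
    rw [conj_formula]
    exact hM.apply_mem b _ (M.mul_mem (hM.conj_mem' hr.2 _) (hlast r hr.1 b))⟩⟩
  have hRQ : R ≤ Q := by
    refine hR.le_of_commutator_mem Q (admissibleNormal_conj_iff.2 hQ) fun r hr b => ?_
    have hr' := hR.admissible.normal.conj_mem r hr b
    refine ⟨R.mul_mem (R.inv_mem hr) hr', ?_⟩
    have : x⁻¹ * φ (r⁻¹ * MulAut.conj b r) x =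
        φ r⁻¹ ((x⁻¹ * φ r x)⁻¹ * (x⁻¹ * φ (b * r * b⁻¹) x)) := by
      simp
    rw [this]
    apply hM.apply_mem
    obtain ⟨b', hb'⟩ := hφ x⁻¹ b
    -- Conjugation by `x⁻¹ b⁻¹(x)` is itself an operator, because inner automorphisms normalize the
    -- operators. Hence applying `φ b` turns the first factor into `b'(x⁻¹ r(x))`, which agrees with
    -- `x⁻¹ r(x)` modulo `M`.
    have hconj : (x⁻¹ * φ b⁻¹ x)⁻¹ * (x⁻¹ * φ r x) * (x⁻¹ * φ b⁻¹ x) =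
        φ (b⁻¹ * b') (x⁻¹ * φ r x) := by
      rw [map_mul φ, MulAut.mul_apply, hb']
      simp [mul_assoc]
    rw [conj_formula, hconj, map_mul (φ b), ← MulAut.mul_apply, ← map_mul φ, ← mul_assoc b,
      mul_inv_cancel, one_mul, ← mul_assoc]
    exact M.mul_mem (h₂ _ ⟨r, hr, rfl⟩ b') (hM.apply_mem b _ (hlast r hr b))
  rintro _ ⟨r, hr, rfl⟩
  exact (hRQ hr).2

end Residual

/-! ### Central elements of hypercentral operator groups. -/

section CentralizerModulo

variable {X B : Type*} [Group X] [Group B] {φ : B →* MulAut X} {M T : Subgroup X}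

/-- The operators that act trivially on `M` modulo the invariant subgroup `T`. -/
def centralizerModulo (φ : B →* MulAut X) (M T : Subgroup X) (hT : ∀ b, ∀ x ∈ T, φ b x ∈ T) :
    Subgroup B where
  carrier := {b | ∀ x ∈ M, x⁻¹ * φ b x ∈ T}
  one_mem' := by simp
  mul_mem' {r s} hr hs x hx := by
    have : x⁻¹ * φ (r * s) x = (x⁻¹ * φ r x) * φ r (x⁻¹ * φ s x) := by simp
    rw [this]
    exact T.mul_mem (hr x hx) (hT r _ (hs x hx))
  inv_mem' {r} hr x hx := by
    have : x⁻¹ * φ r⁻¹ x = (φ r⁻¹ (x⁻¹ * φ r x))⁻¹ := by simp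
    rw [this]
    exact T.inv_mem (hT _ _ (hr x hx))

theorem normal_centralizerModulo (hT : ∀ b, ∀ x ∈ T, φ b x ∈ T) (hM : ∀ b, ∀ x ∈ M, φ b x ∈ M) :
    (centralizerModulo φ M T hT).Normal := by
  refine ⟨fun r hr b x hx => ?_⟩
  have : x⁻¹ * φ (b * r * b⁻¹) x = φ b ((φ b⁻¹ x)⁻¹ * φ r (φ b⁻¹ x)) := by simp
  rw [this]
  exact hT b _ (hr _ (hM b⁻¹ x hx))

theorem ker_le_centralizerModulo (hT : ∀ b, ∀ x ∈ T, φ b x ∈ T) :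
    φ.ker ≤ centralizerModulo φ M T hT := fun b hb x _ => by
  simp [MonoidHom.mem_ker.1 hb]

/-- A nontrivial quotient of the hypercentral group `B/K` has nontrivial centre: otherwise `N` would
be fixed-closed under conjugation and contain the hull of `K`. -/
theorem exists_central_modulo {K N : Subgroup B} (hK : hull MulAut.conj K = ⊤) (hN : N.Normal)
    (hKN : K ≤ N) (hne : N ≠ ⊤) : ∃ a, a ∉ N ∧ ∀ b, a⁻¹ * (b * a * b⁻¹) ∈ N := by
  by_contra! h
  refine hne (top_le_iff.1 (hK.ge.trans (hull_le (admissibleNormal_conj_iff.2 hN) ?_ hKN)))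
  intro a ha
  by_contra haN
  obtain ⟨b, hb⟩ := h a haN
  exact hb (ha b)

theorem apply_comm_of_fixes {a b : B} {x : X} (h : φ (a⁻¹ * (b * a * b⁻¹)) (φ b x) = φ b x) :
    φ a (φ b x) = φ b (φ a x) := by
  have h' := congrArg (φ a) h
  rw [← h']
  simp

end CentralizerModulo

/-! ### Extensions of finite modules without fixed points. -/

section Displacement

variable {X B : Type*} [CommGroup X] [Group B]

/-- The endomorphism `x ↦ x⁻¹ b(x)` of a commutative group. -/
def displacement (φ : B →* MulAut X) (b : B) : X →* X where
  toFun x := x⁻¹ * φ b x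
  map_one' := by simp
  map_mul' x y := by
    rw [map_mul, mul_inv]
    exact mul_mul_mul_comm _ _ _ _

variable {φ : B →* MulAut X}

theorem displacement_apply (b : B) (x : X) : displacement φ b x = x⁻¹ * φ b x := rfl

theorem displacement_comm {a b : B} {x : X} (h : φ a (φ b x) = φ b (φ a x)) :
    displacement φ a (φ b x) = φ b (displacement φ a x) := by
  simp [displacement_apply, h]

/-- For hypercentral operator groups, an extension of a finite module without fixed points by a
trivial module has a nontrivial fixed point, unless it is trivial. -/
theorem le_of_fixedPointFree (hker : hull MulAut.conj φ.ker = ⊤) :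
    ∀ (n : ℕ) (T Z : Subgroup X), Z ≤ T → Finite Z → Nat.card Z = n →
      (∀ t ∈ T, ∀ b, t⁻¹ * φ b t ∈ Z) → (∀ t ∈ T, (∀ b, φ b t = t) → t = 1) → T ≤ Z := by
  intro n
  induction n using Nat.strong_induction_on with
  | _ n ih =>
    intro T Z hZT hfin hn hTZ hfix
    have hT : ∀ b, ∀ x ∈ T, φ b x ∈ T := fun b x hx => by
      simpa using T.mul_mem hx (hZT (hTZ x hx b))
    have hbot : ∀ b, ∀ x ∈ (⊥ : Subgroup X), φ b x ∈ (⊥ : Subgroup X) := by simp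
    by_cases htop : centralizerModulo φ T ⊥ hbot = ⊤
    · intro t ht
      rw [hfix t ht fun b => ?_]
      · exact Z.one_mem
      · have : b ∈ centralizerModulo φ T ⊥ hbot := htop ▸ trivial
        exact (inv_mul_eq_one.1 (this t ht)).symm
    -- As `a` is central modulo the centralizer of `T`, its displacement `δ` commutes with all
    -- operators on `T`; induction applies to its kernel and its image.
    obtain ⟨a, ha, hcomm⟩ := exists_central_modulo hker (normal_centralizerModulo hbot hT)
      (ker_le_centralizerModulo hbot) htop
    set δ := displacement φ a
    have hδ : ∀ b, ∀ t ∈ T, δ (φ b t) = φ b (δ t) := fun b t ht =>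
      displacement_comm (apply_comm_of_fixes (inv_mul_eq_one.1 (hcomm b _ (hT b t ht))).symm)
    have hδ' : ∀ b, ∀ t ∈ T, (δ t)⁻¹ * φ b (δ t) = δ (t⁻¹ * φ b t) := fun b t ht => by
      rw [map_mul, hδ b t ht, map_inv]
    have hδZ : ∀ t ∈ T, δ t ∈ Z := fun t ht => hTZ t ht a
    -- If `δ` killed `Z`, every `δ t` would be a fixed point, hence trivial, and `a` would
    -- centralize `T`.
    have hlt : ¬ Z ≤ δ.ker := by
      intro hle
      refine ha fun t ht => ?_
      refine hfix _ (hZT (hδZ t ht)) fun b => ?_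
      rw [eq_comm, ← inv_mul_eq_one]
      exact (hδ' b t ht).trans (hle (hTZ t ht b))
    have hker : T ⊓ δ.ker ≤ Z ⊓ δ.ker := by
      refine ih _ ?_ (T ⊓ δ.ker) (Z ⊓ δ.ker) (inf_le_inf_right _ hZT)
        (Finite.of_injective _ (Subgroup.inclusion_injective inf_le_left)) rfl
        (fun t ht b => ⟨hTZ t ht.1 b, ?_⟩) (fun t ht => hfix t ht.1)
      · rw [← hn]
        by_contra hcard
        exact hlt (inf_eq_left.1 (Subgroup.eq_of_le_of_card_ge inf_le_left (not_lt.1 hcard)))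
      · change δ _ = 1
        rw [← hδ' b t ht.1, MonoidHom.mem_ker.1 ht.2]
        simp
    have hle : Z.map δ ≤ Z := by
      rintro _ ⟨z, hz, rfl⟩
      exact hδZ z (hZT hz)
    -- Either `δ(Z)` is smaller than `Z` and induction applies, or `δ(Z) = Z`, which contains `δ(T)`
    -- anyway.
    have himage : T.map δ ≤ Z.map δ := by
      by_cases hcard : Nat.card (Z.map δ) < n
      · refine ih _ hcard _ _ (Subgroup.map_mono hZT)
          (Finite.of_injective _ (Subgroup.inclusion_injective hle)) rfl ?_ ?_
        · rintro _ ⟨t, ht, rfl⟩ b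
          exact ⟨_, hTZ t ht b, (hδ' b t ht).symm⟩
        · rintro _ ⟨t, ht, rfl⟩
          exact hfix _ (hZT (hδZ t ht))
      · rw [Subgroup.eq_of_le_of_card_ge hle (hn ▸ not_lt.1 hcard)]
        rintro _ ⟨t, ht, rfl⟩
        exact hδZ t ht
    intro t ht
    obtain ⟨z, hz, hzt⟩ := himage ⟨t, ht, rfl⟩
    have : z⁻¹ * t ∈ Z := (hker ⟨T.mul_mem (T.inv_mem (hZT hz)) ht, by
      simp [hzt]⟩).1
    simpa using Z.mul_mem hz this

end Displacement

/-! ### Operators induced on subgroups and quotients. -/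

section InducedOperators

variable {G B : Type*} [Group G] [Group B]

/-- The action of the operators on an invariant subgroup. -/
def restrictOperators (φ : B →* MulAut G) (M : Subgroup G) (hM : ∀ b, ∀ x ∈ M, φ b x ∈ M) :
    B →* MulAut M where
  toFun b :=
    { toFun := fun x => ⟨φ b x, hM b x x.2⟩
      invFun := fun x => ⟨φ b⁻¹ x, hM b⁻¹ x x.2⟩
      left_inv := fun x => by simp
      right_inv := fun x => by simp
      map_mul' := fun x y => by simp }
  map_one' := by ext x; simp
  map_mul' a b := by ext x; simp

/-- The action of the operators on the quotient by an admissible subgroup. -/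
def quotientOperators (φ : B →* MulAut G) (N : Subgroup G) [N.Normal]
    (hN : AdmissibleNormal φ N) : B →* MulAut (G ⧸ N) where
  toFun b := QuotientGroup.congr N N (φ b) (by
    ext x
    constructor
    · rintro ⟨y, hy, rfl⟩
      exact hN.apply_mem b y hy
    · intro hx
      exact ⟨φ b⁻¹ x, hN.apply_mem _ x hx, by simp⟩)
  map_one' := by
    ext x
    induction x using QuotientGroup.induction_on with
    | H g => simp
  map_mul' a b := by
    ext x
    induction x using QuotientGroup.induction_on with
    | H g => simp

theorem quotientOperators_mk (φ : B →* MulAut G) (N : Subgroup G) [N.Normal]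
    (hN : AdmissibleNormal φ N) (b : B) (x : G) :
    quotientOperators φ N hN b (x : G ⧸ N) = (φ b x : G) := rfl

theorem semiEquivariant_mk' (φ : B →* MulAut G) (N : Subgroup G) [N.Normal]
    (hN : AdmissibleNormal φ N) :
    SemiEquivariant φ (quotientOperators φ N hN) (QuotientGroup.mk' N) :=
  .of_equivariant fun _ _ => rfl

theorem semiEquivariant_subtype (φ : B →* MulAut G) (M : Subgroup G)
    (hM : ∀ b, ∀ x ∈ M, φ b x ∈ M) : SemiEquivariant (restrictOperators φ M hM) φ M.subtype :=
  .of_equivariant fun _ _ => rfl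

end InducedOperators

/-! ### Finite-by-hypertrivial groups are hypertrivial-by-finite. -/

section FiniteByHypertrivial

variable {G B : Type*} [Group G] [Group B] {φ : B →* MulAut G} {L : Subgroup G}

theorem Subgroup.finiteIndex_of_fibers {α : Type*} [Finite α] (H : Subgroup G) (f : G → α)
    (h : ∀ x y, f x = f y → x⁻¹ * y ∈ H) : H.FiniteIndex := by
  have : Finite (G ⧸ H) := by
    refine Finite.of_injective (fun q : G ⧸ H => f q.out) fun p q hpq => ?_
    rw [← p.out_eq', ← q.out_eq', QuotientGroup.eq]
    exact h _ _ hpq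
  exact Subgroup.finiteIndex_of_finite_quotient

/-- The centralizer `K` of both `R` and `L` has finite index, since `R` and `L` are finite and `R`
acts trivially modulo `L`. On `K` the operators act as a hypercentral group, and the module result
above forces `K ≤ L`. -/
theorem finite_of_fixedPointFree (hφ : InnNormalized φ) {R : Subgroup B}
    (hR : IsFiniteResidual MulAut.conj R) (hL : AdmissibleNormal φ L) (hfin : Finite L)
    (hhull : hull φ L = ⊤) (hfix : ∀ x, (∀ b, φ b x = x) → x = 1) : Finite G := by
  have hRf := hR.finite
  let K : Subgroup G :=
    { carrier := {x | (∀ r ∈ R, φ r x = x) ∧ ∀ l ∈ L, x * l = l * x}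
      one_mem' := by simp
      mul_mem' := by
        rintro x y ⟨hx, hx'⟩ ⟨hy, hy'⟩
        refine ⟨fun r hr => by rw [map_mul, hx r hr, hy r hr], fun l hl => ?_⟩
        rw [mul_assoc, hy' l hl, ← mul_assoc, hx' l hl, mul_assoc]
      inv_mem' := by
        rintro x ⟨hx, hx'⟩
        refine ⟨fun r hr => by rw [map_inv, hx r hr], fun l hl => ?_⟩
        rw [inv_mul_eq_iff_eq_mul, ← mul_assoc, hx' l hl, mul_inv_cancel_right] }
  have hKinv : ∀ b, ∀ x ∈ K, φ b x ∈ K := by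
    rintro b x ⟨hx, hx'⟩
    refine ⟨fun r hr => ?_, fun l hl => ?_⟩
    · have := hx _ (by simpa using hR.admissible.normal.conj_mem r hr b⁻¹)
      simpa using congrArg (φ b) this
    · simpa using congrArg (φ b) (hx' _ (hL.apply_mem b⁻¹ l hl))
  have hKfin : K.FiniteIndex := by
    refine K.finiteIndex_of_fibers (α := (R → L) × (L → L))
      (fun x => (fun r => ⟨φ r x * x⁻¹, ?_⟩, fun l => ⟨x * l * x⁻¹, hL.conj_mem l.2 x⟩)) ?_
    · have := hL.conj_mem (hR.inv_mul_apply_mem hφ hL x (hhull ▸ trivial) r r.2) x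
      simpa using this
    · intro x y hxy
      simp only [Prod.mk.injEq, funext_iff, Subtype.mk.injEq, Subtype.forall] at hxy
      refine ⟨fun r hr => ?_, fun l hl => ?_⟩
      · have h := hxy.1 r hr
        rw [map_mul, map_inv, inv_mul_eq_iff_eq_mul, ← mul_assoc, h, inv_mul_cancel_right]
      · have h := hxy.2 l hl
        calc x⁻¹ * y * l = x⁻¹ * (y * l * y⁻¹) * y := by group
          _ = x⁻¹ * (x * l * x⁻¹) * y := by rw [h]
          _ = l * (x⁻¹ * y) := by group
  have hKL : K ≤ L := by
    by_contra hne
    obtain ⟨x, hxK, hxL, hx⟩ := exists_fixed_of_le_hull hφ hL hKinv (by simp [hhull]) hne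
    set V := K ⊓ fixedModulo φ L
    have hVfix : ∀ v ∈ V, ∀ b, v⁻¹ * φ b v ∈ L := fun v hv =>
      (AdmissibleNormal.mem_fixedModulo hL.normal).1 hv.2
    have hVinv : ∀ b, ∀ v ∈ V, φ b v ∈ V := fun b v hv =>
      ⟨hKinv b v hv.1, (hL.fixedModulo hφ).apply_mem b v hv.2⟩
    -- Operators change `v` and `w` only by factors in `L ⊓ K`, which commute with `v`, `w` and each
    -- other. So the commutator of `v` and `w` is fixed, hence trivial.
    have hcomm : ∀ v ∈ V, ∀ w ∈ V, v * w = w * v := by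
      intro v hv w hw
      rw [← mul_inv_eq_one]
      refine hfix _ fun b => ?_
      obtain ⟨l, hl, hvl⟩ : ∃ l, l ∈ L ∧ φ b v = v * l := ⟨_, hVfix v hv b, by simp⟩
      obtain ⟨m, hm, hwm⟩ : ∃ m, m ∈ L ∧ φ b w = w * m := ⟨_, hVfix w hw b, by simp⟩
      have hlK : l ∈ K := by
        have : l = v⁻¹ * φ b v := by rw [hvl]; group
        rw [this]
        exact K.mul_mem (K.inv_mem hv.1) (hKinv b v hv.1)
      have h₁ : φ b v * φ b w = v * w * (l * m) := by
        rw [hvl, hwm, mul_assoc, ← mul_assoc l, ← hw.1.2 l hl]; group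
      have h₂ : φ b w * φ b v = w * v * (l * m) := by
        rw [hvl, hwm, mul_assoc, ← mul_assoc m, ← hv.1.2 m hm, hlK.2 m hm]; group
      rw [map_mul, map_inv, map_mul, map_mul, h₁, h₂]
      group
    let _ : CommGroup V :=
      { (inferInstance : Group V) with
        mul_comm := fun v w => Subtype.ext (hcomm v v.2 w w.2) }
    have hker : hull MulAut.conj (restrictOperators φ V hVinv).ker = ⊤ := by
      refine top_le_iff.1 (hR.hull_eq.ge.trans (hull_mono fun r hr => ?_))
      ext v
      exact v.2.1.1 r hr
    have hfin' : Finite (L.subgroupOf V) :=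
      Finite.of_injective (fun z => (⟨z.1.1, z.2⟩ : L)) fun y z hyz =>
        Subtype.ext (Subtype.ext (congrArg (fun z : L => (z : G)) hyz))
    have := le_of_fixedPointFree hker _ ⊤ (L.subgroupOf V) le_top hfin' rfl
      (fun t _ b => hVfix t t.2 b)
      (fun t _ ht => Subtype.ext (hfix t fun b => congrArg Subtype.val (ht b)))
    exact hxL (this (x := ⟨x, hxK, (AdmissibleNormal.mem_fixedModulo hL.normal).2 hx⟩) trivial)
  have : Finite K := Finite.of_injective _ (Subgroup.inclusion_injective hKL)
  exact Nat.finite_of_card_ne_zero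
    (by rw [← K.card_mul_index]; exact mul_ne_zero Nat.card_pos.ne' hKfin.index_ne_zero)

theorem finiteIndex_hull_bot (hφ : InnNormalized φ) {R : Subgroup B}
    (hR : IsFiniteResidual MulAut.conj R) (hL : AdmissibleNormal φ L) (hfin : Finite L)
    (hhull : hull φ L = ⊤) : (hull φ ⊥).FiniteIndex := by
  have hN : AdmissibleNormal φ (hull φ ⊥) := admissibleNormal_hull
  have := hN.normal
  have hf := semiEquivariant_mk' φ _ hN
  have hs := QuotientGroup.mk'_surjective (hull φ ⊥)
  have hfinite : Finite (G ⧸ hull φ ⊥) := by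
    refine finite_of_fixedPointFree (hf.innNormalized hs hφ) hR (hf.admissibleNormal_map hs hL)
      (Finite.Set.finite_image _ _) ?_ ?_
    · apply Subgroup.comap_injective hs
      rw [hf.comap_hull hs, Subgroup.comap_top]
      exact top_le_iff.1 (hhull.ge.trans (hull_mono (Subgroup.le_comap_map _ _)))
    · intro x hx
      induction x using QuotientGroup.induction_on with
      | H g =>
        rw [QuotientGroup.eq_one_iff]
        refine fixedClosed_hull g fun b => ?_
        rw [← QuotientGroup.eq]
        exact (hx b).symm
  exact Subgroup.finiteIndex_of_finite_quotient

end FiniteByHypertrivial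

/-! ### Fitting's lemma through periodic points. -/

section PeriodicSubgroup

variable {X B : Type*} [CommGroup X] [Group B]

/-- The periodic points of an endomorphism of a commutative group. -/
def periodicSubgroup (δ : X →* X) : Subgroup X where
  carrier := Function.periodicPts δ
  one_mem' := Function.mk_mem_periodicPts one_pos (map_one δ)
  mul_mem' := by
    rintro x y ⟨m, hm, hx⟩ ⟨n, hn, hy⟩
    refine ⟨m * n, Nat.mul_pos hm hn, ?_⟩
    have hx' := hx.mul_const n
    have hy' := hy.const_mul m
    rw [Function.IsPeriodicPt, Function.IsFixedPt] at *
    rw [iterate_map_mul, hx', hy']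
  inv_mem' := by
    rintro x ⟨m, hm, hx⟩
    refine ⟨m, hm, ?_⟩
    rw [Function.IsPeriodicPt, Function.IsFixedPt] at *
    rw [iterate_map_inv, hx]

variable {δ : X →* X} {M T : Subgroup X}

theorem eq_one_of_mem_periodicSubgroup {x : X} (hx : x ∈ periodicSubgroup δ) {n : ℕ}
    (hn : δ^[n] x = 1) : x = 1 := by
  obtain ⟨k, hk, hx⟩ := hx
  have h₁ : δ^[n * k] x = x := hx.const_mul n
  have h₂ : n * k = (n * k - n) + n := by
    have : n ≤ n * k := Nat.le_mul_of_pos_right n hk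
    omega
  rw [← h₁, h₂, Function.iterate_add_apply, hn, iterate_map_one]

/-- The map `δ` is injective on the finite set of cosets `M/T`, so two iterates of `x` in the same
coset can be cancelled back to `x` itself. -/
theorem exists_iterate_mem (hrel : T.relIndex M ≠ 0) (hM : ∀ x ∈ M, δ x ∈ M)
    (hinj : ∀ x ∈ M, δ x ∈ T → x ∈ T) {x : X} (hx : x ∈ M) :
    ∃ k > 0, x⁻¹ * δ^[k] x ∈ T := by
  have hit : ∀ i, ∀ y ∈ M, δ^[i] y ∈ M := by
    intro i y hy
    induction i with
    | zero => exact hy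
    | succ i ih => rw [Function.iterate_succ_apply']; exact hM _ ih
  have hinj' : ∀ i, ∀ y ∈ M, δ^[i] y ∈ T → y ∈ T := by
    intro i
    induction i with
    | zero => exact fun y _ h => h
    | succ i ih =>
      intro y hy h
      rw [Function.iterate_succ_apply'] at h
      exact ih y hy (hinj _ (hit i y hy) h)
  have : (T.subgroupOf M).FiniteIndex := ⟨hrel⟩
  obtain ⟨i, j, hij, h⟩ := Finite.exists_ne_map_eq_of_infinite
    (fun i : ℕ => ((⟨δ^[i] x, hit i x hx⟩ : M) : M ⧸ T.subgroupOf M))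
  wlog hlt : i < j generalizing i j
  · exact this j i hij.symm h.symm (lt_of_le_of_ne (not_lt.1 hlt) hij.symm)
  refine ⟨j - i, Nat.sub_pos_of_lt hlt, hinj' i _ (M.mul_mem (M.inv_mem hx) (hit _ x hx)) ?_⟩
  rw [iterate_map_mul, iterate_map_inv, ← Function.iterate_add_apply, Nat.add_sub_cancel' hlt.le]
  simpa [Subgroup.mem_subgroupOf] using QuotientGroup.eq.1 h

/-- Fitting's lemma for an endomorphism that is nilpotent on `T` and injective modulo `T`. -/
theorem le_sup_periodicSubgroup (hTM : T ≤ M) (hrel : T.relIndex M ≠ 0)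
    (hM : ∀ x ∈ M, δ x ∈ M) (hT : ∀ x ∈ T, δ x ∈ T)
    (hinj : ∀ x ∈ M, δ x ∈ T → x ∈ T) (hnil : ∀ x ∈ T, ∃ n, δ^[n] x = 1) :
    M ≤ T ⊔ (M ⊓ periodicSubgroup δ) := by
  intro x hx
  obtain ⟨k, hk, hkx⟩ := exists_iterate_mem hrel hM hinj hx
  obtain ⟨n, hn⟩ := hnil _ hkx
  have hiter : ∀ i, x⁻¹ * δ^[i * k] x ∈ T := by
    intro i
    induction i with
    | zero => simp
    | succ i ih =>
      have hTk : ∀ m, ∀ y ∈ T, δ^[m] y ∈ T := by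
        intro m y hy
        induction m with
        | zero => exact hy
        | succ m ih => rw [Function.iterate_succ_apply']; exact hT _ ih
      have := T.mul_mem ih (hTk (i * k) _ hkx)
      rw [iterate_map_mul, iterate_map_inv, ← Function.iterate_add_apply] at this
      rw [Nat.succ_mul]
      simpa using this
  have hx' := hiter n
  -- As `δ^[n]` kills `x⁻¹ δ^[k] x`, every iterate of `x` from the `n`-th on has period `k`. The
  -- exponent `n * k` is at least `n`, and as a multiple of `k` it keeps the iterate congruent to
  -- `x` modulo `T`.
  have hper : δ^[n * k] x ∈ periodicSubgroup δ := by
    refine ⟨k, hk, ?_⟩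
    have h₂ : n * k = (n * k - n) + n := by
      have : n ≤ n * k := Nat.le_mul_of_pos_right n hk
      omega
    rw [Function.IsPeriodicPt, Function.IsFixedPt, ← Function.iterate_add_apply, add_comm, h₂,
      add_assoc, Function.iterate_add_apply, Function.iterate_add_apply _ (n * k - n)]
    congr 1
    rw [iterate_map_mul, iterate_map_inv, inv_mul_eq_one, ← Function.iterate_add_apply] at hn
    exact hn.symm
  have hxM : δ^[n * k] x ∈ M := by simpa using M.mul_mem hx (hTM hx')
  have := Subgroup.mul_mem_sup (T.inv_mem hx') (show _ ∈ M ⊓ periodicSubgroup δ from ⟨hxM, hper⟩)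
  simpa using this

end PeriodicSubgroup

/-! ### Splitting a finite submodule off a nontrivial irreducible factor. -/

section HypercentralModule

variable {X B : Type*} [CommGroup X] [Group B] {φ : B →* MulAut X} {M T : Subgroup X}

theorem innNormalized_of_comm : InnNormalized φ := fun g b => ⟨b, fun x => by simp⟩

theorem admissibleNormal_of_comm (h : ∀ b, ∀ x ∈ M, φ b x ∈ M) : AdmissibleNormal φ M :=
  ⟨inferInstance, h⟩

theorem exists_iterate_displacement_eq_one (a : B) :
    ∀ x ∈ hull φ ⊥, ∃ n, (displacement φ a)^[n] x = 1 := by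
  refine hull_induction innNormalized_of_comm .bot _ (fun x hx => ⟨0, hx⟩) ?_
  intro N _ _ hN x hx
  obtain ⟨n, hn⟩ := hN _ (hx a)
  exact ⟨n + 1, hn⟩

/-- Schur's lemma: `a` is central in its action on `M/T`, so the fixed points of `a` there form a
submodule, which is proper because `a` acts nontrivially. -/
theorem mem_of_displacement_mem (hT : ∀ b, ∀ x ∈ T, φ b x ∈ T) (hM : ∀ b, ∀ x ∈ M, φ b x ∈ M)
    (hTM : T ≤ M)
    (hmin : ∀ S : Subgroup X, (∀ b, ∀ x ∈ S, φ b x ∈ S) → T ≤ S → S ≤ M → S = T ∨ S = M)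
    {a : B} (ha : a ∉ centralizerModulo φ M T hT)
    (hcomm : ∀ b, a⁻¹ * (b * a * b⁻¹) ∈ centralizerModulo φ M T hT) :
    ∀ x ∈ M, displacement φ a x ∈ T → x ∈ T := by
  have hS : ∀ b, ∀ x ∈ M ⊓ T.comap (displacement φ a), φ b x ∈ M ⊓ T.comap (displacement φ a) := by
    rintro b x ⟨hx, hx'⟩
    refine ⟨hM b x hx, ?_⟩
    have h₁ := hcomm b _ (hM b x hx)
    have h₂ : displacement φ a (φ b x) = φ b (displacement φ a x) *
        (φ a ((φ b x)⁻¹ * φ (a⁻¹ * (b * a * b⁻¹)) (φ b x)))⁻¹ := by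
      simp [displacement_apply]
    change displacement φ a (φ b x) ∈ T
    rw [h₂]
    exact T.mul_mem (hT b _ hx') (T.inv_mem (hT a _ h₁))
  rcases hmin _ hS (le_inf hTM fun x hx => T.mul_mem (T.inv_mem hx) (hT a x hx)) inf_le_left
    with h | h
  · intro x hx hx'
    rw [← h]
    exact ⟨hx, hx'⟩
  · refine absurd (fun x hx => ?_) ha
    rw [← h] at hx
    exact hx.2

/-- A finite nontrivial irreducible factor above a hypertrivial module is covered by a finite
submodule. -/
theorem exists_finite_supplement (hker : hull MulAut.conj φ.ker = ⊤)
    (hT : ∀ b, ∀ x ∈ T, φ b x ∈ T) (hM : ∀ b, ∀ x ∈ M, φ b x ∈ M) (hTM : T ≤ M)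
    (hhyp : T ≤ hull φ ⊥) (hrel : T.relIndex M ≠ 0)
    (hmin : ∀ S : Subgroup X, (∀ b, ∀ x ∈ S, φ b x ∈ S) → T ≤ S → S ≤ M → S = T ∨ S = M)
    (hne : centralizerModulo φ M T hT ≠ ⊤) :
    ∃ L : Subgroup X, (∀ b, ∀ x ∈ L, φ b x ∈ L) ∧ Finite L ∧ M ≤ T ⊔ L := by
  obtain ⟨a, ha, hcomm⟩ := exists_central_modulo hker (normal_centralizerModulo hT hM)
    (ker_le_centralizerModulo hT) hne
  have hnil : ∀ b, ∀ x ∈ T, ∃ n, (displacement φ b)^[n] x = 1 := fun b x hx =>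
    exists_iterate_displacement_eq_one b x (hhyp hx)
  have hMd : ∀ b, ∀ x ∈ M, displacement φ b x ∈ M := fun b x hx =>
    M.mul_mem (M.inv_mem hx) (hM b x hx)
  have hTd : ∀ b, ∀ x ∈ T, displacement φ b x ∈ T := fun b x hx =>
    T.mul_mem (T.inv_mem hx) (hT b x hx)
  set L := M ⊓ periodicSubgroup (displacement φ a) with hLdef
  have hsup : M ≤ T ⊔ L := le_sup_periodicSubgroup hTM hrel (hMd a) (hTd a)
    (mem_of_displacement_mem hT hM hTM hmin ha hcomm) (hnil a)
  have hdisj : ∀ x ∈ T, x ∈ L → x = 1 := by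
    rintro x hx ⟨-, hx'⟩
    obtain ⟨n, hn⟩ := hnil a x hx
    exact eq_one_of_mem_periodicSubgroup hx' hn
  have hbot : T.subgroupOf L = ⊥ := by
    rw [eq_bot_iff]
    intro x hx
    exact Subtype.ext (hdisj x hx x.2)
  -- Nilpotent and periodic points meet trivially, so `L` embeds in the finite group `M/T`.
  have hfin : Finite L := by
    have h : T.relIndex L ≠ 0 := fun h =>
      hrel (Subgroup.relIndex_eq_zero_of_le_right inf_le_left h)
    rw [Subgroup.relIndex, hbot, Subgroup.index_bot] at h
    exact Nat.finite_of_card_ne_zero h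
  refine ⟨L, ?_, hfin, hsup⟩
  have hkera : AdmissibleNormal MulAut.conj φ.ker := admissibleNormal_conj_iff.2 inferInstance
  -- Invariance of `L` is not automatic, since `a` is central only modulo the centralizer of `M/T`.
  -- Take `N` maximal normal fixing `L` pointwise: either `N` is everything, or some `q` central
  -- modulo `N` moves `L`, and then `q` commutes with all operators on `L` and replaces `a`.
  obtain ⟨N, hN, -, hNfix, h | ⟨q, hq, hqL⟩⟩ :=
    exists_maximal_admissible_forall innNormalized_conj hkera
    (fun b => ∀ l ∈ L, φ b l = l) (fun b hb l _ => by simp [MonoidHom.mem_ker.1 hb])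
  · intro b l hl
    rwa [hNfix b (h (hker ▸ trivial)) l hl]
  have hqcomm : ∀ b, ∀ l ∈ L, φ q (φ b l) = φ b (φ q l) := by
    intro b l hl
    have hc : b⁻¹ * q⁻¹ * b * q ∈ N := by
      simpa [mul_assoc] using N.inv_mem (hq b⁻¹)
    have := congrArg (fun y => φ q (φ b y)) (hNfix _ hc l hl)
    simpa using this.symm
  have hqLmem : ∀ l ∈ L, φ q l ∈ L := by
    intro l hl
    obtain ⟨n, hn, hper⟩ := hl.2
    refine ⟨hM q l hl.1, n, hn, ?_⟩
    have hLd : ∀ i, (displacement φ a)^[i] l ∈ L ∧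
        (displacement φ a)^[i] (φ q l) = φ q ((displacement φ a)^[i] l) := by
      intro i
      induction i with
      | zero => exact ⟨hl, rfl⟩
      | succ i ih =>
        rw [Function.iterate_succ_apply', Function.iterate_succ_apply', ih.2]
        refine ⟨⟨hMd a _ ih.1.1, ?_⟩, displacement_comm (hqcomm a _ ih.1).symm⟩
        rw [← Function.iterate_succ_apply' (displacement φ a)]
        obtain ⟨m, hm, hm'⟩ := hl.2
        exact ⟨m, hm, hm'.apply_iterate (i + 1)⟩
    rw [Function.IsPeriodicPt, Function.IsFixedPt, (hLd n).2, hper]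
  have hNle : ∀ c ∈ N, c ∈ centralizerModulo φ M T hT := by
    intro c hc m hm
    obtain ⟨t, ht, l, hl, rfl⟩ := Subgroup.mem_sup.1 (hsup hm)
    have : (t * l)⁻¹ * φ c (t * l) = t⁻¹ * φ c t := by
      rw [map_mul, hNfix c hc l hl, mul_inv, mul_mul_mul_comm, inv_mul_cancel, mul_one]
    rw [this]
    exact T.mul_mem (T.inv_mem ht) (hT c t ht)
  -- If `q` centralized `M/T`, the displacements of `L` under `q` would lie in `T ⊓ L = 1`.
  have hqN : q ∉ centralizerModulo φ M T hT := by
    intro hqc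
    refine hqL fun l hl => ?_
    exact (inv_mul_eq_one.1 (hdisj _ (hqc l hl.1) (L.mul_mem (L.inv_mem hl) (hqLmem l hl)))).symm
  have hinjq := mem_of_displacement_mem hT hM hTM hmin hqN fun b => hNle _ (hq b)
  have hLq : ∀ x ∈ L, displacement φ q x ∈ L := fun l hl =>
    L.mul_mem (L.inv_mem hl) (hqLmem l hl)
  -- The displacement of `q` is injective on the finite group `L`, so all of `L` is periodic for it.
  have hLper : ∀ l ∈ L, l ∈ periodicSubgroup (displacement φ q) := by
    intro l hl
    obtain ⟨k, hk, hkl⟩ := exists_iterate_mem (T := ⊥)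
      (by rw [Subgroup.relIndex_bot_left]; exact Nat.card_pos.ne') hLq
      (fun x hx hx' => hdisj x (hinjq x hx.1 (by rw [Subgroup.mem_bot.1 hx']; exact T.one_mem)) hx)
      hl
    exact ⟨k, hk, (inv_mul_eq_one.1 hkl).symm⟩
  intro b l hl
  have hbl : φ b l ∈ periodicSubgroup (displacement φ q) := by
    obtain ⟨n, hn, hper⟩ := hLper l hl
    have hLd : ∀ i, (displacement φ q)^[i] l ∈ L ∧
        (displacement φ q)^[i] (φ b l) = φ b ((displacement φ q)^[i] l) := by
      intro i
      induction i with
      | zero => exact ⟨hl, rfl⟩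
      | succ i ih =>
        rw [Function.iterate_succ_apply', Function.iterate_succ_apply', ih.2]
        exact ⟨hLq _ ih.1, displacement_comm (hqcomm b _ ih.1)⟩
    refine ⟨n, hn, ?_⟩
    rw [Function.IsPeriodicPt, Function.IsFixedPt, (hLd n).2, hper]
  -- The `T`-component of `φ b l` is both periodic and nilpotent for `displacement φ q`, hence
  -- trivial.
  obtain ⟨t, ht, l', hl', heq⟩ := Subgroup.mem_sup.1 (hsup (hM b l hl.1))
  have htper : t ∈ periodicSubgroup (displacement φ q) := by
    have : t = φ b l * l'⁻¹ := by rw [← heq]; simp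
    rw [this]
    exact Subgroup.mul_mem _ hbl (Subgroup.inv_mem _ (hLper l' hl'))
  obtain ⟨n, hn⟩ := hnil q t ht
  rw [← heq, eq_one_of_mem_periodicSubgroup htper hn, one_mul]
  exact hl'

end HypercentralModule

/-! ### Abelian hypertrivial-by-finite groups. -/

section HypercentralModule

variable {X B : Type*} [CommGroup X] [Group B] {φ : B →* MulAut X}

theorem Subgroup.finite_comap {G H : Type*} [Group G] [Group H] (f : G →* H) {S : Subgroup H}
    (hS : Finite S) (hker : Finite f.ker) : Finite (S.comap f) := by
  refine Set.Finite.to_subtype (Set.Finite.preimage' (s := (S : Set H)) (Set.toFinite _) ?_)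
  intro y _
  rcases (f ⁻¹' {y}).eq_empty_or_nonempty with h | ⟨x, hx⟩
  · rw [h]; exact Set.finite_empty
  · refine ((Set.toFinite (f.ker : Set G)).image (x * ·)).subset fun z hz => ⟨x⁻¹ * z, ?_, by simp⟩
    have hx : f x = y := hx
    have hz : f z = y := hz
    simp [MonoidHom.mem_ker, hx, hz]

theorem ker_le_ker_quotientOperators {G : Type*} [Group G] (φ : B →* MulAut G) (N : Subgroup G)
    [N.Normal] (hN : AdmissibleNormal φ N) : φ.ker ≤ (quotientOperators φ N hN).ker := by
  intro b hb
  ext x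
  induction x using QuotientGroup.induction_on with
  | H g => simp [quotientOperators_mk, MonoidHom.mem_ker.1 hb]

/-- An admissible `M` of least index over `T = hull φ ⊥` gives an irreducible factor `M/T`, on which
the action is nontrivial because `T` is fixed-closed. Its finite supplement enlarges the hull. -/
theorem exists_finite_lt_hull (hker : hull MulAut.conj φ.ker = ⊤)
    (hfin : (hull φ ⊥).FiniteIndex) (hne : hull φ ⊥ ≠ ⊤) :
    ∃ L, AdmissibleNormal φ L ∧ Finite L ∧ hull φ ⊥ < hull φ L := by
  set T := hull φ ⊥ with hTdef
  have hT : AdmissibleNormal φ T := admissibleNormal_hull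
  have hS : {M : Subgroup X | AdmissibleNormal φ M ∧ T < M}.Nonempty :=
    ⟨⊤, .top, lt_top_iff_ne_top.2 hne⟩
  obtain ⟨hM, hTM⟩ := Function.argminOn_mem (fun M : Subgroup X => T.relIndex M) _ hS
  have hmin := fun S hS' => Function.argminOn_le (fun M : Subgroup X => T.relIndex M)
    {M : Subgroup X | AdmissibleNormal φ M ∧ T < M} (a := S) hS'
  set M := Function.argminOn (fun M : Subgroup X => T.relIndex M) _ hS
  have hrel : ∀ S, T.relIndex S ≠ 0 := fun S => by
    have : (T.subgroupOf S).FiniteIndex := inferInstance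
    exact this.index_ne_zero
  obtain ⟨L, hL, hLfin, hML⟩ := exists_finite_supplement hker hT.apply_mem hM.apply_mem hTM.le
    le_rfl (hrel M) (fun S hS hTS hSM => by
      rcases hTS.eq_or_lt with h | h
      · exact Or.inl h.symm
      · right
        have h₁ := hmin S ⟨admissibleNormal_of_comm hS, h⟩
        have h₂ := Subgroup.relIndex_mul_relIndex T S M hTS hSM
        have h₃ : S.relIndex M ≤ 1 := by
          by_contra hlt
          have := Nat.pos_of_ne_zero (hrel S)
          nlinarith
        refine le_antisymm hSM (Subgroup.relIndex_eq_one.1 (le_antisymm h₃ ?_))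
        refine Nat.one_le_iff_ne_zero.2 fun h0 => hrel M ?_
        rw [← h₂, h0, mul_zero])
    (fun htop => hTM.not_ge fun x hx => fixedClosed_hull x fun b =>
      (htop ▸ Subgroup.mem_top b : b ∈ centralizerModulo φ M T _) x hx)
  refine ⟨L, admissibleNormal_of_comm hL, hLfin, hTM.trans_le (hML.trans (sup_le ?_ le_hull))⟩
  exact hull_mono bot_le

/-- Among finite admissible `L`, take one whose hull has least index; were the hull proper, the
preceding lemma in `X/L` would enlarge it. -/
theorem exists_finite_hull_eq_top_of_ker (hker : hull MulAut.conj φ.ker = ⊤)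
    (hfin : (hull φ ⊥).FiniteIndex) :
    ∃ L, AdmissibleNormal φ L ∧ Finite L ∧ hull φ L = ⊤ := by
  have hne : {L : Subgroup X | AdmissibleNormal φ L ∧ Finite L}.Nonempty :=
    ⟨⊥, .bot, inferInstance⟩
  obtain ⟨hL, hLfin⟩ := Function.argminOn_mem (fun L : Subgroup X => (hull φ L).index) _ hne
  have hmin := fun S hS => Function.argminOn_le (fun L : Subgroup X => (hull φ L).index)
    {L : Subgroup X | AdmissibleNormal φ L ∧ Finite L} (a := S) hS
  set L := Function.argminOn (fun L : Subgroup X => (hull φ L).index) _ hne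
  refine ⟨L, hL, hLfin, ?_⟩
  by_contra htop
  have hf := semiEquivariant_mk' φ L hL
  have hs := QuotientGroup.mk'_surjective L
  have hcomap : (hull (quotientOperators φ L hL) ⊥).comap (QuotientGroup.mk' L) = hull φ L := by
    rw [hf.comap_hull hs, MonoidHom.comap_bot, QuotientGroup.ker_mk']
  have hLidx : (hull φ L).FiniteIndex := Subgroup.finiteIndex_of_le (hull_mono bot_le)
  obtain ⟨L', hL', hL'fin, hlt⟩ := exists_finite_lt_hull (φ := quotientOperators φ L hL)
    (top_le_iff.1 (hker.ge.trans (hull_mono (ker_le_ker_quotientOperators φ L hL))))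
    ⟨by rw [← Subgroup.index_comap_of_surjective _ hs, hcomap]; exact hLidx.index_ne_zero⟩
    (fun h => htop (by rw [← hcomap, h, Subgroup.comap_top]))
  have hmin' := hmin (L'.comap (QuotientGroup.mk' L)) ⟨hf.admissibleNormal_comap hL',
    Subgroup.finite_comap _ hL'fin (by rw [QuotientGroup.ker_mk']; exact hLfin)⟩
  rw [← hf.comap_hull hs, ← hcomap] at hmin'
  have : ((hull (quotientOperators φ L hL) ⊥).comap (QuotientGroup.mk' L)).FiniteIndex :=
    hcomap ▸ hLidx
  exact hmin'.not_gt (Subgroup.index_strictAnti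
    ((Subgroup.comap_lt_comap_of_surjective hs).2 hlt))

/-- The group `W = [X, R]` is finite: `R` fixes `hull φ ⊥` pointwise, so `x⁻¹ r(x)` depends only on
`r` and the coset of `x`, and its order divides the index `k`. Modulo `W` the residual acts
trivially. -/
theorem exists_finite_hull_eq_top {R : Subgroup B} (hR : IsFiniteResidual MulAut.conj R)
    (hfin : (hull φ ⊥).FiniteIndex) :
    ∃ L, AdmissibleNormal φ L ∧ Finite L ∧ hull φ L = ⊤ := by
  have hRf := hR.finite
  set k := (hull φ ⊥).index
  set s : Set X := {y | ∃ r ∈ R, ∃ x, x⁻¹ * φ r x = y}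
  have hW : AdmissibleNormal φ (Subgroup.closure s) := by
    refine AdmissibleNormal.closure (fun y hy g => by simpa using hy) ?_
    rintro _ ⟨r, hr, x, rfl⟩ b
    exact ⟨b * r * b⁻¹, hR.admissible.normal.conj_mem r hr b, φ b x, by simp⟩
  have hsfin : s.Finite := by
    have : s ⊆ Set.range fun p : R × (X ⧸ hull φ ⊥) => p.2.out⁻¹ * φ p.1 p.2.out := by
      rintro _ ⟨r, hr, x, rfl⟩
      refine ⟨(⟨r, hr⟩, (x : X ⧸ hull φ ⊥)), ?_⟩
      obtain ⟨t, ht⟩ := QuotientGroup.mk_out_eq_mul (hull φ ⊥) x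
      have h := hR.inv_mul_apply_mem innNormalized_of_comm .bot (t : X) t.2 r hr
      change _⁻¹ * φ r _ = _
      rw [ht, map_mul, mul_inv, mul_mul_mul_comm, Subgroup.mem_bot.1 h, mul_one]
    exact (Set.finite_range _).subset this
  have hWfin : Finite (Subgroup.closure s) := by
    have hfg : Group.FG (Subgroup.closure s) :=
      (Group.fg_iff_subgroup_fg _).2 ⟨hsfin.toFinset, by simp⟩
    refine CommGroup.finite_of_fg_isMulTorsion _ fun w => ?_
    rw [isOfFinOrder_iff_pow_eq_one]
    refine ⟨k, Nat.pos_of_ne_zero hfin.index_ne_zero, ?_⟩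
    have : Subgroup.closure s ≤ (powMonoidHom k).ker := by
      rw [Subgroup.closure_le]
      rintro _ ⟨r, hr, x, rfl⟩
      have hx : x ^ k ∈ hull φ ⊥ := Subgroup.pow_index_mem _ x
      have h := hR.inv_mul_apply_mem innNormalized_of_comm .bot _ hx r hr
      rw [Subgroup.mem_bot, map_pow] at h
      simpa [MonoidHom.mem_ker, mul_pow] using h
    exact Subtype.ext (this w.2)
  set W := Subgroup.closure s
  have hf := semiEquivariant_mk' φ W hW
  have hs := QuotientGroup.mk'_surjective W
  obtain ⟨L, hL, hLfin, htop⟩ := exists_finite_hull_eq_top_of_ker (φ := quotientOperators φ W hW)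
    (top_le_iff.1 (hR.hull_eq.ge.trans (hull_mono fun r hr => by
      ext x
      induction x using QuotientGroup.induction_on with
      | H x =>
        rw [quotientOperators_mk, MulAut.one_apply, eq_comm, QuotientGroup.eq]
        exact Subgroup.subset_closure ⟨r, hr, x, rfl⟩)))
    ⟨by
      rw [← Subgroup.index_comap_of_surjective _ hs, hf.comap_hull hs]
      exact (Subgroup.finiteIndex_of_le (hull_mono bot_le)).index_ne_zero⟩
  refine ⟨L.comap (QuotientGroup.mk' W), hf.admissibleNormal_comap hL,
    Subgroup.finite_comap _ hLfin (by rw [QuotientGroup.ker_mk']; exact hWfin), ?_⟩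
  rw [← hf.comap_hull hs, htop, Subgroup.comap_top]

end HypercentralModule

/-! ### Reduction of the hypertrivial-by-finite case to abelian groups. -/

section HypertrivialByFinite

variable {G B : Type*} [Group G] [Group B] {φ : B →* MulAut G} {K L M : Subgroup G}

/-- Schur's theorem: a commutator depends only on the cosets of its entries modulo the centre, and
finitely many commutators generate a finite subgroup. -/
theorem finite_commutator_of_finiteIndex_center {G : Type*} [Group G]
    (h : (Subgroup.center G).FiniteIndex) : Finite (commutator G) := by
  have : Finite (commutatorSet G) := by
    refine Set.Finite.to_subtype ((Set.finite_range fun p : (G ⧸ Subgroup.center G) ×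
      (G ⧸ Subgroup.center G) => p.1.out * p.2.out * p.1.out⁻¹ * p.2.out⁻¹).subset ?_)
    rintro _ ⟨x, y, rfl⟩
    refine ⟨((x : G ⧸ Subgroup.center G), (y : G ⧸ Subgroup.center G)), ?_⟩
    obtain ⟨⟨z, hz⟩, hz'⟩ := QuotientGroup.mk_out_eq_mul (Subgroup.center G) x
    obtain ⟨⟨w, hw⟩, hw'⟩ := QuotientGroup.mk_out_eq_mul (Subgroup.center G) y
    simp only at hz' hw'
    have hz := Subgroup.mem_center_iff.1 hz
    have hw := Subgroup.mem_center_iff.1 hw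
    change _ * _ * _⁻¹ * _⁻¹ = x * y * x⁻¹ * y⁻¹
    rw [hz', hw', mul_inv_rev, mul_inv_rev]
    calc x * z * (y * w) * (z⁻¹ * x⁻¹) * (w⁻¹ * y⁻¹)
        = x * (z * (y * w * z⁻¹)) * (x⁻¹ * w⁻¹ * y⁻¹) := by group
      _ = x * (y * w) * (x⁻¹ * w⁻¹ * y⁻¹) := by rw [← hz]; group
      _ = x * y * (w * (x⁻¹ * w⁻¹)) * y⁻¹ := by group
      _ = x * y * x⁻¹ * y⁻¹ := by rw [← hw]; group
  infer_instance

theorem apply_inv_of_eq_conj {b : B} {y : G} (h : ∀ z, φ b z = y * z * y⁻¹) (z : G) :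
    φ b⁻¹ z = y⁻¹ * z * y :=
  (φ b).injective (by
    rw [h (y⁻¹ * z * y), ← MulAut.mul_apply, ← map_mul, mul_inv_cancel, map_one, MulAut.one_apply]
    group)

theorem mem_hull_restrictOperators (hφ : InnNormalized φ) (hM : ∀ b, ∀ x ∈ M, φ b x ∈ M) :
    (hull φ ⊥).subgroupOf M ≤ hull (restrictOperators φ M hM) ⊥ := by
  suffices ∀ x ∈ hull φ ⊥, ∀ hx : x ∈ M, (⟨x, hx⟩ : M) ∈ hull (restrictOperators φ M hM) ⊥ from
    fun x hx => this x hx x.2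
  refine hull_induction hφ .bot _ ?_ fun N _ _ hN x hx hxM => fixedClosed_hull _ fun b =>
    hN _ (hx b) (M.mul_mem (M.inv_mem hxM) (hM b x hxM))
  intro x hx hxM
  have : (⟨x, hxM⟩ : M) = 1 := Subtype.ext hx
  rw [this]
  exact Subgroup.one_mem _

theorem innNormalized_restrictOperators (hφ : InnNormalized φ) (hM : ∀ b, ∀ x ∈ M, φ b x ∈ M) :
    InnNormalized (restrictOperators φ M hM) := by
  intro g b
  obtain ⟨b', hb'⟩ := hφ g b
  exact ⟨b', fun x => Subtype.ext (hb' x)⟩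

/-- A finite subgroup with hypertrivial quotient in `M` can be chosen normal in `G`. -/
theorem exists_finite_admissible_of_restrict (hφ : InnNormalized φ) (hM : AdmissibleNormal φ M)
    {S : Subgroup M} (hS : AdmissibleNormal (restrictOperators φ M hM.apply_mem) S)
    (hfin : Finite S) (htop : hull (restrictOperators φ M hM.apply_mem) S = ⊤) :
    ∃ L, AdmissibleNormal φ L ∧ Finite L ∧ M ≤ hull φ L := by
  have hψ := innNormalized_restrictOperators hφ hM.apply_mem
  -- `S` is normal only in `M`. The finite residual of `M` is canonical, hence invariant under
  -- conjugation by all of `G`.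
  obtain ⟨R, hR⟩ := exists_isFiniteResidual hS hfin htop
  have hRfin := hR.finite
  refine ⟨R.map M.subtype, ⟨⟨?_⟩, ?_⟩, Finite.Set.finite_image _ _, ?_⟩
  · rintro _ ⟨r, hr, rfl⟩ g
    let f : M →* M :=
      ((MulAut.conj g).toMonoidHom.comp M.subtype).codRestrict M fun x => hM.conj_mem x.2 g
    have hf : SemiEquivariant (restrictOperators φ M hM.apply_mem)
        (restrictOperators φ M hM.apply_mem) f := by
      have h := hφ.semiEquivariant_conj g
      constructor
      · intro b
        obtain ⟨c, hc⟩ := h.exists_right b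
        exact ⟨c, fun x => Subtype.ext (hc x)⟩
      · intro c
        obtain ⟨b, hb⟩ := h.exists_left c
        exact ⟨b, fun x => Subtype.ext (hb x)⟩
    have hs : Function.Surjective f := fun y => ⟨⟨g⁻¹ * y * g, hM.conj_mem' y.2 g⟩,
      Subtype.ext (by simp [f, mul_assoc])⟩
    exact ⟨f r, hR.apply_mem hψ hf hs hr, rfl⟩
  · rintro b _ ⟨r, hr, rfl⟩
    exact ⟨_, hR.admissible.apply_mem b r hr, rfl⟩
  · intro x hx
    have h := (semiEquivariant_subtype φ M hM.apply_mem).hull_le_comap (L := R)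
      (L' := R.map M.subtype) ((Subgroup.le_comap_map _ _).trans (Subgroup.comap_mono le_hull))
    rw [hR.hull_eq] at h
    exact h (x := ⟨x, hx⟩) trivial

theorem exists_finite_hull_eq_top_of_center {R : Subgroup B} (hR : IsFiniteResidual MulAut.conj R)
    (hcenter : (Subgroup.center G).FiniteIndex) (hfin : (hull φ ⊥).FiniteIndex) :
    ∃ L, AdmissibleNormal φ L ∧ Finite L ∧ hull φ L = ⊤ := by
  have hW : AdmissibleNormal φ (commutator G) := ⟨inferInstance, fun b x hx =>
    (Subgroup.characteristic_iff_le_comap.1 inferInstance (φ b)) hx⟩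
  have hWfin := finite_commutator_of_finiteIndex_center hcenter
  let _ : CommGroup (G ⧸ commutator G) := inferInstanceAs (CommGroup (Abelianization G))
  have hf := semiEquivariant_mk' φ (commutator G) hW
  have hs := QuotientGroup.mk'_surjective (commutator G)
  obtain ⟨L, hL, hLfin, htop⟩ := exists_finite_hull_eq_top
    (φ := quotientOperators φ (commutator G) hW) hR ⟨by
      rw [← Subgroup.index_comap_of_surjective _ hs, hf.comap_hull hs]
      exact (Subgroup.finiteIndex_of_le (hull_mono bot_le)).index_ne_zero⟩
  refine ⟨L.comap (QuotientGroup.mk' (commutator G)), hf.admissibleNormal_comap hL,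
    Subgroup.finite_comap _ hLfin (by rw [QuotientGroup.ker_mk']; exact hWfin), ?_⟩
  rw [← hf.comap_hull hs, htop, Subgroup.comap_top]

/-- A hypertrivial-by-finite admissible subgroup is finite-by-hypertrivial. -/
theorem exists_finite_le_hull_of_relIndex (hφ : InnNormalized φ) {R : Subgroup B}
    (hR : IsFiniteResidual MulAut.conj R)
    (hRinn : ∀ g, ∀ r ∈ R, ∃ r' ∈ R, ∀ x, φ r' x = g * φ r (g⁻¹ * x * g) * g⁻¹)
    (hK : AdmissibleNormal φ K) (hrel : (hull φ ⊥).relIndex K ≠ 0) :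
    ∃ L, AdmissibleNormal φ L ∧ Finite L ∧ K ≤ hull φ L := by
  have hRf := hR.finite
  set C := Subgroup.closure {y | ∃ x ∈ K, ∃ b, x⁻¹ * φ b x = y}
  have hC : AdmissibleNormal φ C := by
    refine AdmissibleNormal.closure ?_ ?_
    · rintro _ ⟨x, hx, b, rfl⟩ g
      obtain ⟨b', hb'⟩ := hφ g b
      exact ⟨g * x * g⁻¹, hK.conj_mem hx g, b', by rw [hb']; simp [mul_assoc]⟩
    · rintro _ ⟨x, hx, b, rfl⟩ c
      exact ⟨φ c x, hK.apply_mem c x hx, c * b * c⁻¹, by simp⟩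
  have hCK : C ≤ K := by
    rw [Subgroup.closure_le]
    rintro _ ⟨x, hx, b, rfl⟩
    exact K.mul_mem (K.inv_mem hx) (hK.apply_mem b x hx)
  have hKC : K ≤ hull φ C := fun x hx => fixedClosed_hull x fun b =>
    le_hull (Subgroup.subset_closure ⟨x, hx, b, rfl⟩)
  -- For `y = x⁻¹ b(x)`, conjugation by `y` is the quotient of `b` conjugated by `x⁻¹` and `b`, both
  -- of which are operators.
  have hCinn : ∀ y ∈ C, ∃ b, ∀ z, φ b z = y * z * y⁻¹ := by
    intro y hy
    induction hy using Subgroup.closure_induction with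
    | mem y hy =>
      obtain ⟨x, hx, b, rfl⟩ := hy
      obtain ⟨b', hb'⟩ := hφ x⁻¹ b
      exact ⟨b' * b⁻¹, fun z => by rw [map_mul, MulAut.mul_apply, hb']; simp [mul_assoc]⟩
    | one => exact ⟨1, by simp⟩
    | mul x y _ _ hx hy =>
      obtain ⟨b, hb⟩ := hx
      obtain ⟨c, hc⟩ := hy
      exact ⟨b * c, fun z => by rw [map_mul, MulAut.mul_apply, hc, hb]; group⟩
    | inv x _ hx =>
      obtain ⟨b, hb⟩ := hx
      exact ⟨b⁻¹, fun z => by rw [inv_inv]; exact apply_inv_of_eq_conj hb z⟩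
  let M : Subgroup G :=
    { carrier := {y | y ∈ C ∧ ∃ r ∈ R, ∀ z, φ r z = y * z * y⁻¹}
      one_mem' := ⟨C.one_mem, 1, R.one_mem, by simp⟩
      mul_mem' := by
        rintro x y ⟨hx, r, hr, hr'⟩ ⟨hy, s, hs, hs'⟩
        exact ⟨C.mul_mem hx hy, r * s, R.mul_mem hr hs, fun z => by
          rw [map_mul, MulAut.mul_apply, hs', hr']; group⟩
      inv_mem' := by
        rintro x ⟨hx, r, hr, hr'⟩
        exact ⟨C.inv_mem hx, r⁻¹, R.inv_mem hr, fun z => by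
          rw [inv_inv]; exact apply_inv_of_eq_conj hr' z⟩ }
  have hM : AdmissibleNormal φ M := by
    refine ⟨⟨?_⟩, ?_⟩
    · rintro y ⟨hy, r, hr, hr'⟩ g
      obtain ⟨s, hs, hs'⟩ := hRinn g r hr
      exact ⟨hC.conj_mem hy g, s, hs, fun z => by rw [hs', hr']; group⟩
    · rintro b y ⟨hy, r, hr, hr'⟩
      refine ⟨hC.apply_mem b y hy, b * r * b⁻¹, hR.admissible.normal.conj_mem r hr b, fun z => ?_⟩
      rw [map_mul, map_mul, MulAut.mul_apply, MulAut.mul_apply, hr']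
      simp
  -- This transfers the hypercentrality of `B/R` to `C`: if `b` induces conjugation by `y`, then
  -- `b⁻¹ (a b a⁻¹)` induces conjugation by `y⁻¹ a(y)`.
  have hCM : C ≤ hull φ M := by
    have : ∀ b ∈ hull MulAut.conj R, ∀ y ∈ C, (∀ z, φ b z = y * z * y⁻¹) → y ∈ hull φ M := by
      refine hull_induction innNormalized_conj hR.admissible _
        (fun r hr y hy hr' => le_hull ⟨hy, r, hr, hr'⟩) fun N _ _ hN b hb y hy hby =>
        fixedClosed_hull y fun a => hN _ (hb a) _
          (C.mul_mem (C.inv_mem hy) (hC.apply_mem a y hy)) fun z => ?_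
      have hinv := apply_inv_of_eq_conj hby
      simp only [MulAut.conj_apply, map_mul, MulAut.mul_apply, hinv, hby]
      simp [mul_assoc]
    intro y hy
    obtain ⟨b, hb⟩ := hCinn y hy
    exact this b (hR.hull_eq ▸ trivial) y hy hb
  -- Elements of `M` whose conjugations come from the same `r ∈ R` agree modulo the centre, and `R`
  -- is finite.
  have hcenter : (Subgroup.center M).FiniteIndex := by
    choose r hr hr' using fun y : M => y.2.2
    refine Subgroup.finiteIndex_of_fibers _ (fun y : M => (⟨r y, hr y⟩ : R)) fun x y hxy => ?_
    rw [Subgroup.mem_center_iff]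
    intro z
    have hxy : r x = r y := congrArg Subtype.val hxy
    have h : (x : G) * z * (x : G)⁻¹ = y * z * (y : G)⁻¹ := by rw [← hr', ← hr', hxy]
    refine Subtype.ext ?_
    calc (z : G) * ((x : G)⁻¹ * y) = (x : G)⁻¹ * (x * z * (x : G)⁻¹) * y := by group
      _ = (x : G)⁻¹ * y * z := by rw [h]; group
  have hrelM : (hull φ ⊥).relIndex M ≠ 0 := fun h =>
    hrel (Subgroup.relIndex_eq_zero_of_le_right (show M ≤ K from fun y hy => hCK hy.1) h)
  have hfin : (hull (restrictOperators φ M hM.apply_mem) ⊥).FiniteIndex := by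
    have : ((hull φ ⊥).subgroupOf M).FiniteIndex := ⟨hrelM⟩
    exact Subgroup.finiteIndex_of_le (mem_hull_restrictOperators hφ hM.apply_mem)
  obtain ⟨S, hS, hSfin, hStop⟩ := exists_finite_hull_eq_top_of_center hR hcenter hfin
  obtain ⟨L, hL, hLfin, hML⟩ := exists_finite_admissible_of_restrict hφ hM hS hSfin hStop
  exact ⟨L, hL, hLfin, hKC.trans (hull_le_hull (hCM.trans (hull_le_hull hML)))⟩

theorem exists_finite_le_hull (hφ : InnNormalized φ) {R : Subgroup B}
    (hR : IsFiniteResidual MulAut.conj R)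
    (hRinn : ∀ g, ∀ r ∈ R, ∃ r' ∈ R, ∀ x, φ r' x = g * φ r (g⁻¹ * x * g) * g⁻¹)
    (hK : AdmissibleNormal φ K) (hL : AdmissibleNormal φ L) (hLfin : Finite L)
    (hrel : (hull φ L).relIndex K ≠ 0) :
    ∃ L', AdmissibleNormal φ L' ∧ Finite L' ∧ K ≤ hull φ L' := by
  have := hL.normal
  have hf := semiEquivariant_mk' φ L hL
  have hs := QuotientGroup.mk'_surjective L
  have hcomap : (hull (quotientOperators φ L hL) ⊥).comap (QuotientGroup.mk' L) = hull φ L := by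
    rw [hf.comap_hull hs, MonoidHom.comap_bot, QuotientGroup.ker_mk']
  obtain ⟨S, hS, hSfin, hKS⟩ := exists_finite_le_hull_of_relIndex
    (hf.innNormalized hs hφ) hR (fun g r hr => by
      obtain ⟨g, rfl⟩ := hs g
      obtain ⟨r', hr', h⟩ := hRinn g r hr
      refine ⟨r', hr', fun x => ?_⟩
      obtain ⟨x, rfl⟩ := hs x
      exact congrArg (QuotientGroup.mk' L) (h x))
    (hf.admissibleNormal_map hs hK) (by rwa [← Subgroup.relIndex_comap, hcomap])
  refine ⟨S.comap (QuotientGroup.mk' L), hf.admissibleNormal_comap hS,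
    Subgroup.finite_comap _ hSfin (by rw [QuotientGroup.ker_mk']; exact hLfin), ?_⟩
  rw [← hf.comap_hull hs]
  exact Subgroup.map_le_iff_le_comap.1 hKS

end HypertrivialByFinite

/-! ### From the transfinite upper central series to hulls. -/

section Hypercentral

theorem transfiniteCenter_le_hull (H : Type u) [Group H] (α : Ordinal.{u}) :
    transfiniteCenter H α ≤ hull (MulAut.conj : H →* MulAut H) ⊥ := by
  unfold transfiniteCenter
  induction α using Ordinal.limitRecOn with
  | zero =>
    rw [transfiniteCenterAux, Ordinal.limitRecOn_zero]
    exact bot_le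
  | add_one α ih =>
    rw [transfiniteCenterAux, Ordinal.limitRecOn_add_one]
    change (centerStep (transfiniteCenterAux H α)).1 ≤ _
    have := (transfiniteCenterAux H α).2
    intro x hx
    refine fixedClosed_hull x fun b => ih ?_
    have h := Subgroup.mem_center_iff.1 (Subgroup.mem_comap.1 hx) (b : H ⧸ _)
    have h' : (x : H ⧸ (transfiniteCenterAux H α).1) = ((b * x * b⁻¹ : H) : H ⧸ _) := by
      rw [QuotientGroup.mk_mul, QuotientGroup.mk_mul, QuotientGroup.mk_inv]
      exact eq_mul_inv_of_mul_eq h.symm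
    exact QuotientGroup.eq.1 h'
  | limit l hl ih =>
    rw [transfiniteCenterAux, Ordinal.limitRecOn_limit _ _ _ _ hl]
    exact iSup_le fun b => ih b.1 b.2

theorem IsHypercentral.hull_eq_top {H : Type u} [Group H] (h : IsHypercentral H) :
    hull (MulAut.conj : H →* MulAut H) ⊥ = ⊤ := by
  obtain ⟨α, hα⟩ := h
  exact top_le_iff.1 (hα.ge.trans (transfiniteCenter_le_hull H α))

theorem semiEquivariant_conj_of_surjective {H H' : Type*} [Group H] [Group H'] {f : H →* H'}
    (hf : Function.Surjective f) :
    SemiEquivariant (MulAut.conj : H →* MulAut H) (MulAut.conj : H' →* MulAut H') f :=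
  ⟨fun b => ⟨f b, fun x => by simp⟩, fun c => by
    obtain ⟨b, rfl⟩ := hf c
    exact ⟨b, fun x => by simp⟩⟩

theorem IsFiniteByHypercentral.exists_isFiniteResidual {H : Type u} [Group H]
    (h : IsFiniteByHypercentral H) :
    ∃ R, IsFiniteResidual (MulAut.conj : H →* MulAut H) R := by
  obtain ⟨F, hF, hfin, hyp⟩ := h
  have hs := QuotientGroup.mk'_surjective F
  refine _root_.exists_isFiniteResidual (admissibleNormal_conj_iff.2 hF) hfin ?_
  have := (semiEquivariant_conj_of_surjective hs).comap_hull hs (L' := ⊥)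
  rw [hyp.hull_eq_top, Subgroup.comap_top, MonoidHom.comap_bot, QuotientGroup.ker_mk'] at this
  exact this.symm

end Hypercentral

/-! ### Ascending series and hulls. -/

section Series

variable {G B : Type u} [Group G] [Group B] {φ : B →* MulAut G}

/-- The hull of `⊥` is reached by iterating the monotone operator `fixedModulo φ` from `⊥`; the
ordinal approximations to its least fixed point are the series. -/
theorem exists_stabilized_series (hφ : InnNormalized φ) :
    ∃ (τ : Ordinal.{u}) (S : Ordinal.{u} → Subgroup G),
      IsAscendingNormalSeries S τ (hull φ ⊥) ∧ Stabilizes φ S τ := by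
  let f : Subgroup G →o Subgroup G := ⟨fixedModulo φ, fixedModulo_mono⟩
  let S : Ordinal.{u} → Subgroup G := OrdinalApprox.lfpApprox f ⊥
  have hmono : Monotone S := OrdinalApprox.lfpApprox_mono_right f
  have hzero : S 0 = ⊥ := OrdinalApprox.lfpApprox_zero f
  have hsucc : ∀ β, S (β + 1) = fixedModulo φ (S β) := OrdinalApprox.lfpApprox_add_one f bot_le
  have hlim : ∀ l, Order.IsSuccLimit l → S l = ⨆ b : Set.Iio l, S b := fun l hl =>
    OrdinalApprox.lfpApprox_of_isSuccLimit f hl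
  have hdir : ∀ l : Ordinal.{u}, Directed (· ≤ ·) fun b : Set.Iio l => S b := fun l =>
    Monotone.directed_le fun a b hab => hmono hab
  have hS : ∀ β, AdmissibleNormal φ (S β) ∧ S β ≤ hull φ ⊥ := by
    intro β
    induction β using Ordinal.limitRecOn with
    | zero => rw [hzero]; exact ⟨.bot, bot_le⟩
    | add_one β ih =>
      rw [hsucc]
      exact ⟨ih.1.fixedModulo hφ, (fixedModulo_mono ih.2).trans
        ((fixedClosed_iff admissibleNormal_hull.normal).1 fixedClosed_hull)⟩
    | limit l hl ih =>
      rw [hlim l hl]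
      refine ⟨?_, iSup_le fun b => (ih b b.2).2⟩
      refine AdmissibleNormal.sSup_of_isChain ⟨_, ⟨⟨0, hl.bot_lt⟩, rfl⟩⟩ ?_ ?_
      · rintro _ ⟨a, rfl⟩ _ ⟨b, rfl⟩ -
        exact (le_total a b).imp (fun h => hmono h) (fun h => hmono h)
      · rintro _ ⟨b, rfl⟩
        exact (ih b b.2).1
  obtain ⟨τ, hτ⟩ : ∃ τ, S (τ + 1) = S τ := by
    refine ⟨_, (hsucc _).trans (Function.mem_fixedPoints_iff.1
      (OrdinalApprox.lfpApprox_ord_mem_fixedPoint f bot_le))⟩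
  refine ⟨τ, S, ⟨fun β _ => (hS β).1.normal, fun β γ h _ => hmono h, hzero, ?_, ?_⟩, ?_⟩
  · refine le_antisymm (hS τ).2 (hull_le (hS τ).1 ?_ bot_le)
    rw [fixedClosed_iff (hS τ).1.normal, ← hsucc, hτ]
  · intro l _ hl x
    have : Nonempty (Set.Iio l) := ⟨⟨0, hl.bot_lt⟩⟩
    rw [hlim l hl, Subgroup.mem_iSup_of_directed (hdir l)]
    simp
  · intro β _ b g hg
    rw [hsucc] at hg
    exact (AdmissibleNormal.mem_fixedModulo (hS β).1.normal).1 hg b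

variable {τ : Ordinal.{u}} {S : Ordinal.{u} → Subgroup G} {E : Set Ordinal.{u}} {K : Subgroup G}

theorem IsAscendingNormalSeries.le_of_fixedClosed {K' : Subgroup G}
    (hS : IsAscendingNormalSeries S τ K')
    (htriv : ∀ β < τ, β ∉ E → ActsTriviallyOnFactor φ S β) (hK : FixedClosed φ K)
    {β : Ordinal.{u}} (hβ : S β ≤ K) :
    ∀ γ ≤ τ, β ≤ γ → (∀ δ, β ≤ δ → δ < γ → δ ∉ E) → S γ ≤ K := by
  intro γ
  induction γ using Ordinal.limitRecOn with
  | zero =>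
    intro _ h _
    rwa [← le_antisymm h bot_le]
  | add_one γ ih =>
    intro hγ h hE
    rcases h.eq_or_lt with rfl | h
    · exact hβ
    have h := Order.lt_add_one_iff.1 h
    have hlt := Order.add_one_le_iff.1 hγ
    have := ih hlt.le h fun δ h₁ h₂ => hE δ h₁ (h₂.trans (lt_add_one γ))
    exact fun x hx => hK x fun b => this (htriv γ hlt (hE γ h (lt_add_one γ)) b x hx)
  | limit γ hγl ih =>
    intro hγ h hE x hx
    rcases h.eq_or_lt with rfl | h
    · exact hβ hx
    obtain ⟨δ, hδ, hx⟩ := (hS.limit γ hγ hγl x).1 hx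
    have hlt : max δ β < γ := max_lt hδ h
    exact ih _ hlt (hlt.le.trans hγ) (le_max_right _ _)
      (fun ε h₁ h₂ => hE ε h₁ (h₂.trans hlt))
      (hS.mono δ _ (le_max_left _ _) (hlt.le.trans hγ) hx)

/-- The terms are assumed only normal in `G`; invariance of `S β` comes from the trivial action on
the factor just above it. -/
theorem IsAscendingNormalSeries.admissibleNormal (hS : IsAscendingNormalSeries S τ K)
    {β : Ordinal.{u}} (hβ : β < τ) (h : ActsTriviallyOnFactor φ S β) :
    AdmissibleNormal φ (S β) := by
  refine ⟨hS.normal β hβ.le, fun b x hx => ?_⟩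
  have := h b x (hS.mono β (β + 1) (le_add_of_nonneg_right zero_le_one)
    (Order.add_one_le_of_lt hβ) hx)
  simpa using (S β).mul_mem hx this

/-- The invariant asks only for finite relative index, because a term followed by a finite factor
need not be admissible, and `exists_finite_le_hull` applies only to admissible terms. -/
theorem IsAscendingNormalSeries.exists_finite_relIndex (hφ : InnNormalized φ) {R : Subgroup B}
    (hR : IsFiniteResidual MulAut.conj R)
    (hRinn : ∀ g, ∀ r ∈ R, ∃ r' ∈ R, ∀ x, φ r' x = g * φ r (g⁻¹ * x * g) * g⁻¹)
    (hS : IsAscendingNormalSeries S τ K) (hE : E.Finite)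
    (hfin : ∀ β < τ, β ∈ E → FactorFinite S β)
    (htriv : ∀ β < τ, β ∉ E → ActsTriviallyOnFactor φ S β) :
    ∀ β ≤ τ, ∃ L, AdmissibleNormal φ L ∧ Finite L ∧ (hull φ L).relIndex (S β) ≠ 0 := by
  intro β
  induction β using Ordinal.limitRecOn with
  | zero =>
    intro _
    refine ⟨⊥, .bot, inferInstance, ?_⟩
    rw [hS.zero, Subgroup.relIndex_bot_right]
    exact one_ne_zero
  | add_one β ih =>
    intro hβ
    have hlt := Order.add_one_le_iff.1 hβ
    obtain ⟨L, hL, hLfin, hrel⟩ := ih hlt.le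
    by_cases hβE : β ∈ E
    · refine ⟨L, hL, hLfin, Subgroup.relIndex_ne_zero_trans hrel ?_⟩
      have := hfin β hlt hβE
      exact (Subgroup.finiteIndex_iff_finite_quotient.2 this).index_ne_zero
    · obtain ⟨L', hL', hL'fin, hle⟩ := exists_finite_le_hull hφ hR hRinn
        (hS.admissibleNormal hlt (htriv β hlt hβE)) hL hLfin hrel
      refine ⟨L', hL', hL'fin, ?_⟩
      rw [Subgroup.relIndex_eq_one.2 fun x hx => fixedClosed_hull x fun b =>
        hle (htriv β hlt hβE b x hx)]
      exact one_ne_zero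
  | limit l hl ih =>
    intro hlτ
    have hEl : (E ∩ Set.Iio l).Finite := hE.inter_of_left _
    -- Beyond the last exceptional index below `l` all factors are trivial, so a hull containing `S
    -- β` contains `S l`.
    obtain ⟨β, hβl, hβ⟩ : ∃ β < l, ∀ δ, β ≤ δ → δ < l → δ ∉ E := by
      refine ⟨hEl.toFinset.sup Order.succ, (Finset.sup_lt_iff hl.bot_lt).2 fun δ hδ => ?_, ?_⟩
      · exact hl.succ_lt (hEl.mem_toFinset.1 hδ).2
      · intro δ hδ hδl hδE
        have := Finset.le_sup (f := Order.succ) (hEl.mem_toFinset.2 ⟨hδE, hδl⟩)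
        exact (Order.succ_le_iff.1 (this.trans hδ)).false
    have hβτ := hβl.trans_le hlτ
    obtain ⟨L, hL, hLfin, hrel⟩ := ih β hβl hβτ.le
    obtain ⟨L', hL', hL'fin, hle⟩ := exists_finite_le_hull hφ hR hRinn
      (hS.admissibleNormal hβτ (htriv β hβτ (hβ β le_rfl hβl))) hL hLfin hrel
    refine ⟨L', hL', hL'fin, ?_⟩
    rw [Subgroup.relIndex_eq_one.2
      (hS.le_of_fixedClosed htriv fixedClosed_hull hle l hlτ hβl.le hβ)]
    exact one_ne_zero

end Series

/-! ### Groups of automorphisms normalized by the inner automorphisms. -/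

section AutomorphismGroup

variable {G : Type u} [Group G] {A : Subgroup (MulAut G)} {L R : Subgroup G}

theorem innNormalized_subtype
    (hInn : ∀ g : G, ∀ a ∈ A, MulAut.conj g * a * (MulAut.conj g)⁻¹ ∈ A) :
    InnNormalized A.subtype := fun g b =>
  ⟨⟨_, hInn g b b.2⟩, fun x => by simp [← map_inv]⟩

/-- Conjugation by an inner automorphism of `G` is an automorphism of `A`, possibly not inner in
`A`; normality of `R` in `A` does not suffice, but its minimality does. -/
theorem IsFiniteResidual.exists_conj_mem
    (hInn : ∀ g : G, ∀ a ∈ A, MulAut.conj g * a * (MulAut.conj g)⁻¹ ∈ A) {R : Subgroup A}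
    (hR : IsFiniteResidual MulAut.conj R) (g : G) :
    ∀ r ∈ R, ∃ r' ∈ R, ∀ x, A.subtype r' x = g * A.subtype r (g⁻¹ * x * g) * g⁻¹ := by
  intro r hr
  let f : A →* A := ((MulAut.conj (MulAut.conj g)).toMonoidHom.comp A.subtype).codRestrict A
    fun a => hInn g a a.2
  have hs : Function.Surjective f := fun a =>
    ⟨⟨_, hInn g⁻¹ a a.2⟩, Subtype.ext (by simp [f, mul_assoc])⟩
  refine ⟨f r, hR.apply_mem innNormalized_conj (semiEquivariant_conj_of_surjective hs) hs hr,
    fun x => ?_⟩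
  simp [f, ← map_inv]

theorem AdmissibleNormal.isInvariantUnder (hL : AdmissibleNormal A.subtype L) :
    IsInvariantUnder A L := by
  intro a ha
  ext x
  constructor
  · rintro ⟨y, hy, rfl⟩
    exact hL.apply_mem ⟨a, ha⟩ y hy
  · intro hx
    exact ⟨a⁻¹ x, hL.apply_mem ⟨a⁻¹, A.inv_mem ha⟩ x hx, MulAut.apply_inv_self G a x⟩

end AutomorphismGroup

theorem mainTheorem5 {G : Type u} [Group G] (A : Subgroup (MulAut G))
    (hA : IsFiniteByHypercentral A)
    (hInn : ∀ g : G, ∀ a ∈ A, MulAut.conj g * a * (MulAut.conj g)⁻¹ ∈ A)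
    (hseries : ∃ (τ : Ordinal.{u}) (S : Ordinal.{u} → Subgroup G) (E : Set Ordinal.{u}),
      IsAscendingNormalSeries S τ ⊤ ∧ E.Finite ∧
      (∀ β < τ, β ∈ E → FactorFinite S β) ∧
      (∀ β < τ, β ∉ E → ActsTriviallyOnFactor A.subtype S β)) :
    (∃ G₀ : Subgroup G, G₀.Normal ∧ IsInvariantUnder A G₀ ∧ G₀.FiniteIndex ∧
      ∃ (τ : Ordinal.{u}) (S : Ordinal.{u} → Subgroup G),
        IsAscendingNormalSeries S τ G₀ ∧ Stabilizes A.subtype S τ) ∧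
    (∃ (L : Subgroup G) (_ : L.Normal) (hL : IsInvariantUnder A L), Finite L ∧
      ∃ (τ : Ordinal.{u}) (S : Ordinal.{u} → Subgroup (G ⧸ L)),
        IsAscendingNormalSeries S τ ⊤ ∧ Stabilizes (quotientAction A L hL) S τ) := by
  obtain ⟨τ, S, E, hS, hE, hfin, htriv⟩ := hseries
  have hφ := innNormalized_subtype hInn
  obtain ⟨R, hR⟩ := hA.exists_isFiniteResidual
  have hRinn := hR.exists_conj_mem hInn
  obtain ⟨L₀, hL₀, hL₀fin, hrel⟩ := hS.exists_finite_relIndex hφ hR hRinn hE hfin htriv τ le_rfl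
  rw [hS.last] at hrel
  -- At the top of the series the finite index is traded once more, giving (ii); (i) then follows
  -- from `finiteIndex_hull_bot`.
  obtain ⟨L, hL, hLfin, htop⟩ := exists_finite_le_hull hφ hR hRinn .top hL₀ hL₀fin hrel
  have htop := top_le_iff.1 htop
  refine ⟨⟨hull A.subtype ⊥, admissibleNormal_hull.normal, admissibleNormal_hull.isInvariantUnder,
    finiteIndex_hull_bot hφ hR hL hLfin htop, exists_stabilized_series hφ⟩, ?_⟩
  have := hL.normal
  have hs := QuotientGroup.mk'_surjective L
  have hf : SemiEquivariant A.subtype (quotientAction A L hL.isInvariantUnder)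
      (QuotientGroup.mk' L) := .of_equivariant fun _ _ => rfl
  refine ⟨L, hL.normal, hL.isInvariantUnder, hLfin, ?_⟩
  have hquot : hull (quotientAction A L hL.isInvariantUnder) ⊥ = ⊤ := by
    apply Subgroup.comap_injective hs
    rw [hf.comap_hull hs, MonoidHom.comap_bot, QuotientGroup.ker_mk', htop, Subgroup.comap_top]
  rw [← hquot]
  exact exists_stabilized_series (hf.innNormalized hs hφ)
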